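/- Let $G$ be an abelian group. A function $f:\mathbb{N}\to G$ is periodic with period $q\ge 1$ if $f(k+q)=f(k)$ for all $k\ge 0$. Let $G^\rho$ be the group of all periodic functions $\mathbb{N}\to G$ under the pointwise operation, and for $m\ge 0$ let $G^\rho_m$ be the subgroup of all $f\in G^\rho$ with $f(k)=0$ for all $0\le k\le m-1$. A non-empty tuple $u=(g_0,\dots,g_{q-1})$ over $G$ defines the periodic function $f_u$ with $f_u(nq+r)=g_r$ for $n\ge 0$, $0\le r<q$. (1) Suppose that $G$ is finitely generated, and fix any finite generating set $\Sigma$ such that every element of $G$ is represented by a word over $\Sigma$. The uniform membership problem $\mathrm{Membership}(G^\rho_*)$ has as input non-empty tuples $u_1,\dots,u_n$ of elements of $G$, these elements being given by words over $\Sigma$, and a number $m\ge 0$ in binary; the question is whether $\sum_{i=1}^n f_{u_i}\in G^\rho_m$. This problem belongs to $\mathsf{TC}^0$, that is, it is decided by a DLOGTIME-uniform family of threshold circuits (AND, OR, NOT and majority gates, where AND, OR and majority gates have unbounded fan-in) of polynomial size and constant depth. (2) Let $f_1,\dots,f_n:\mathbb{N}\to G$ be periodic with periods $q_1,\dots,q_n\ge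 1$, respectively, and let $f=\sum_{i=1}^n f_i$. If $f(m)\ne 0$ for some $m\ge 0$, then $f(m)\ne 0$ for some $m<\sum_{i=1}^n q_i$. -/

import Mathlib

/-! ### Periodic sequences over a group -/

/-- The subgroup `G^ρ` of `G^ω = (ℕ → G)` (pointwise multiplication) of all periodic sequences. -/
def periodicSubgroup (G : Type*) [Group G] : Subgroup (ℕ → G) where
  carrier := {f | ∃ q : ℕ, 1 ≤ q ∧ Function.Periodic f q}
  one_mem' := ⟨1, le_refl 1, fun _ => rfl⟩
  mul_mem' := by
    rintro f g ⟨p, hp, hf⟩ ⟨q, hq, hg⟩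
    refine ⟨p * q, Nat.mul_pos hp hq, fun k => ?_⟩
    have h1 : f (k + p * q) = f k := by
      have := hf.nat_mul q k
      rwa [Nat.cast_id, mul_comm] at this
    have h2 : g (k + p * q) = g k := by
      have := hg.nat_mul p k
      rwa [Nat.cast_id] at this
    simp only [Pi.mul_apply, h1, h2]
  inv_mem' := by
    rintro f ⟨p, hp, hf⟩
    exact ⟨p, hp, fun k => by simp only [Pi.inv_apply, hf k]⟩

/-- The subgroup `G^ρ_n` of all periodic sequences `f` with `f k = 1` for all `0 ≤ k ≤ n - 1`. -/
def periodicVanishingSubgroup (G : Type*) [Group G] (n : ℕ) : Subgroup (ℕ → G) where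
  carrier := {f | f ∈ periodicSubgroup G ∧ ∀ k < n, f k = 1}
  one_mem' := ⟨one_mem _, fun _ _ => rfl⟩
  mul_mem' := by
    rintro f g ⟨hf, hf'⟩ ⟨hg, hg'⟩
    exact ⟨mul_mem hf hg, fun k hk => by simp [hf' k hk, hg' k hk]⟩
  inv_mem' := by
    rintro f ⟨hf, hf'⟩
    exact ⟨inv_mem hf, fun k hk => by simp [hf' k hk]⟩

/-- The periodic sequence `f_u = u^ω` given by a nonempty tuple `u = (g_0, …, g_{q-1})`:
`f_u (n * q + r) = g_r` for `0 ≤ r < q`. -/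
def tupleSeq {G : Type*} [Group G] (u : List G) (k : ℕ) : G :=
  u.getD (k % u.length) 1

/-! ### The uniform membership problem as a formal language -/

/-- Alphabet for inputs of the membership problem: the generators (letters from `S`), a terminator
for the entries of a tuple, a terminator for tuples, and binary digits. -/
inductive InputSymbol (S : Type) : Type
  | letter (s : S)
  | endEntry
  | endTuple
  | bit (b : Bool)
  deriving DecidableEq, Fintype

/-- A tuple of words over the generators, every word closed by `endEntry`, the tuple closed by
`endTuple`. -/
def encodeTuple {S : Type} (u : List (List S)) : List (InputSymbol S) :=
  (u.flatMap fun w => w.map InputSymbol.letter ++ [InputSymbol.endEntry]) ++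
    [InputSymbol.endTuple]

/-- The tuples one after the other, then the number `m` in binary (least significant digit first,
without superfluous zeros). -/
def encodeInstance {S : Type} (us : List (List (List S))) (m : ℕ) : List (InputSymbol S) :=
  us.flatMap encodeTuple ++ (Nat.bits m).map InputSymbol.bit

/-- The tuple of group elements represented by a tuple of words over the generators `a`. -/
def evalTuple {G : Type*} [Group G] {S : Type} (a : S → G) (u : List (List S)) : List G :=
  u.map fun w => (w.map a).prod

/-- `Membership(G^ρ_*)`, with elements of `G` represented by words over the generators `a`: the set
of encodings of all `u_1, …, u_n ∈ G⁺` and `m` such that `f_{u_1} ∘ ⋯ ∘ f_{u_n} ∈ G^ρ_m`. -/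
def membershipProblem {G : Type*} [Group G] {S : Type} (a : S → G) : Language (InputSymbol S) :=
  {x | ∃ (us : List (List (List S))) (m : ℕ), (∀ u ∈ us, u ≠ []) ∧ x = encodeInstance us m ∧
    (us.map fun u => tupleSeq (evalTuple a u)).prod ∈ periodicVanishingSubgroup G m}

/-! ### Threshold circuits -/

namespace Threshold

/-- The operations computed by inner gates, all of unbounded fan-in except for negation. -/
inductive Op : Type
  | and
  | or
  | not
  | maj
  deriving DecidableEq

instance : Fintype Op :=
  ⟨{Op.and, Op.or, Op.not, Op.maj}, fun o => by cases o <;> simp⟩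

/-- The label of a gate in a circuit for words of length `n` over the alphabet `A`. The input gate
`input i s` is the literal "the `i`-th letter of the input is `s`". -/
inductive GateLabel (A : Type) (n : ℕ) : Type
  | input (i : Fin n) (s : A)
  | inner (o : Op)

/-- A threshold circuit for words of length `n` over the alphabet `A`. Its gates are numbered from
`0` to `size - 1`, and `children g` are the gates that feed into `g`. -/
structure Circuit (A : Type) (n : ℕ) where
  size : ℕ
  label : Fin size → GateLabel A n
  children : Fin size → Finset (Fin size)
  acyclic : WellFounded fun h g => h ∈ children g
  children_input : ∀ g i s, label g = GateLabel.input i s → children g = ∅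
  card_children_not : ∀ g, label g = GateLabel.inner Op.not → (children g).card = 1
  output : Fin size

namespace Circuit

variable {A : Type} {n : ℕ}

/-- The truth value of a gate on the input word `x`. A conjunction (disjunction) without children is
the constant true (false); a majority gate is true if at least half of its children are. -/
def value (C : Circuit A n) (x : Fin n → A) : Fin C.size → Prop :=
  C.acyclic.fix fun g ih =>
    match C.label g with
    | .input i s => x i = s
    | .inner .and => ∀ (h : Fin C.size) (hh : h ∈ C.children g), ih h hh
    | .inner .or => ∃ (h : Fin C.size) (hh : h ∈ C.children g), ih h hh
    | .inner .not => ∀ (h : Fin C.size) (hh : h ∈ C.children g), ¬ ih h hh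
    | .inner .maj =>
        (C.children g).card ≤
          2 * {h : Fin C.size | ∃ hh : h ∈ C.children g, ih h hh}.ncard

theorem value_eq (C : Circuit A n) (x : Fin n → A) (g : Fin C.size) :
    C.value x g =
      match C.label g with
      | .input i s => x i = s
      | .inner .and => ∀ h ∈ C.children g, C.value x h
      | .inner .or => ∃ h ∈ C.children g, C.value x h
      | .inner .not => ∀ h ∈ C.children g, ¬ C.value x h
      | .inner .maj =>
          (C.children g).card ≤ 2 * {h | h ∈ C.children g ∧ C.value x h}.ncard := by
  unfold value
  rw [WellFounded.fix_eq]
  split <;> simp [exists_prop]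

/-- The circuit accepts the word `x`. -/
def Accepts (C : Circuit A n) (x : Fin n → A) : Prop :=
  C.value x C.output

/-- Every path in the circuit has length at most `d`: the gates can be arranged in levels
`0, …, d` such that every child of a gate has a smaller level. -/
def DepthLE (C : Circuit A n) (d : ℕ) : Prop :=
  ∃ level : Fin C.size → ℕ,
    (∀ g, ∀ h ∈ C.children g, level h < level g) ∧ ∀ g, level g ≤ d

end Circuit

/-! ### Uniformity -/

/-- Questions on the structure of a circuit (about gates given by their numbers): Is `g` an input
gate that tests whether the `i`-th letter is `s`? Is `g` an inner gate with operation `o`? Is `h`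
a child of `g`? Is `g` the output gate? -/
inductive Query (A : Type) : Type
  | input (g i : ℕ) (s : A)
  | inner (g : ℕ) (o : Op)
  | child (g h : ℕ)
  | output (g : ℕ)

/-- The correct answer to a question on the circuit `C`. -/
def Query.Holds {A : Type} {n : ℕ} (C : Circuit A n) : Query A → Prop
  | .input g i s => ∃ (hg : g < C.size) (hi : i < n), C.label ⟨g, hg⟩ = .input ⟨i, hi⟩ s
  | .inner g o => ∃ hg : g < C.size, C.label ⟨g, hg⟩ = .inner o
  | .child g h => ∃ (hg : g < C.size) (hh : h < C.size), ⟨h, hh⟩ ∈ C.children ⟨g, hg⟩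
  | .output g => (C.output : ℕ) = g

/-- Alphabet for writing down questions on circuits. -/
inductive QuerySymbol (A : Type) : Type
  | input (s : A)
  | inner (o : Op)
  | child
  | output
  | bit (b : Bool)
  | sep
  deriving DecidableEq, Fintype

/-- A list of numbers in binary (least significant digit first), each closed by `sep`. -/
def encodeNumbers {A : Type} (l : List ℕ) : List (QuerySymbol A) :=
  l.flatMap fun k => (Nat.bits k).map QuerySymbol.bit ++ [QuerySymbol.sep]

/-- The word that encodes the pair of an input length `n` and a question on the `n`-th circuit. -/
def encodeQuery {A : Type} : ℕ × Query A → List (QuerySymbol A)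
  | (n, .input g i s) => .input s :: encodeNumbers [n, g, i]
  | (n, .inner g o) => .inner o :: encodeNumbers [n, g]
  | (n, .child g h) => .child :: encodeNumbers [n, g, h]
  | (n, .output g) => .output :: encodeNumbers [n, g]

open Classical in
/-- The characteristic function of the direct connection language of a family of circuits. -/
noncomputable def directConnection {A : Type} (C : ∀ n : ℕ, Circuit A n) (p : ℕ × Query A) : Bool :=
  decide (p.2.Holds (C p.1))

/-- DLOGTIME-uniformity: a deterministic Turing machine (with finitely many stacks, each over a
finite alphabet) decides the direct connection language in time linear in the length of the
encoding of `⟨n, question⟩`. All numbers are written in binary; hence for families of polynomial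
size the time is `O(log n)` for questions on gates of the `n`-th circuit. -/
def DLogTimeUniform {A : Type} (C : ∀ n : ℕ, Circuit A n) : Prop :=
  ∃ M : Turing.TM2ComputableInTime encodeQuery Computability.encodeBool (directConnection C),
    (∀ k, Finite (M.tm.Γ k)) ∧ ∃ c : ℕ, ∀ l : ℕ, M.time l ≤ c * (l + 1)

end Threshold

/-- The class `TC⁰`: languages decided by DLOGTIME-uniform families of threshold circuits of
polynomial size and constant depth. -/
def InTC0 {A : Type} (L : Language A) : Prop :=
  ∃ C : ∀ n : ℕ, Threshold.Circuit A n,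
    (∃ c : ℕ, ∀ n, (C n).size ≤ n ^ c + c) ∧
    (∃ d : ℕ, ∀ n, (C n).DepthLE d) ∧
    Threshold.DLogTimeUniform C ∧
    ∀ x : List A, x ∈ L ↔ (C x.length).Accepts x.get

/-! For (2), compare the product f with its shift by one of the periods, q_j. In f(k + q_j) / f(k)
the factor f_j cancels, and what is left is a product of sequences with the other periods that is
trivial on a segment as long as the sum of those periods. By induction on the number of factors it
is trivial everywhere, so f has period q_j, and f is trivial because it is trivial at the first q_j
places (`prod_eq_one_of_periodic`).

For (1), this tames the binary number m. The sum of the tuple lengths is at most the input length,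
so it suffices to test the k < m below 2^L, where L is the bit length of the input length
(`prod_tupleSeq_mem_iff`). As G is abelian, the value at k depends only on the number v_s of
occurrences of each generator s in the entries selected by k. All that depends on the input is found
by counting, which majority gates can do. Entry e of a tuple of length q is selected iff k = t * q +
e for some t, and t * q + e is the size of a set of pairs (`contributes_iff`). The test k < m counts
the numbers whose leading digit is at a place where m has a one (`ltNumber_iff`). The remaining
question, whether ∏ a_s ^ v_s = 1, is a conjunction of linear equations over ℤ and over finite
cyclic groups, by the structure theorem; a finite automaton that reads binary digits decides it
(`Automatic.prod_pow_eq_one`).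

Uniformity is proved once, for all properties built from letter tests, automatic relations and
threshold gates that quantify over numbers below 2^L (`System`, `Definable`). A gate is a node of a
fixed finite system together with an assignment of numbers to variables; its number is the code of
the node followed by the interleaved digits of the assignment. Questions on the circuit thereby
become automatic relations between assignments, and a machine that reads the numbers in parallel,
block by block, answers them in linear time (`exists_linear_time_of_automatic`). Automatic atoms
need no subcircuits: each is a constant gate whose value the uniformity machine computes. -/

/-! ### Automatic relations -/

/-- A relation between natural numbers is automatic if it belongs to a finite family of relations
that is closed under reading off the least significant binary digits of all arguments. -/
def Automatic {ι : Type} (R : (ι → ℕ) → Prop) : Prop :=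
  ∃ (Q : Type) (_ : Finite Q) (q₀ : Q) (δ : Q → (ι → Bool) → Q) (P : Q → (ι → ℕ) → Prop),
    P q₀ = R ∧ ∀ q v, P q v ↔ P (δ q fun i => (v i).testBit 0) (fun i => v i / 2)

namespace Automatic

variable {ι κ : Type} {R R' : (ι → ℕ) → Prop}

theorem const (p : Prop) : Automatic fun _ : ι → ℕ => p :=
  ⟨Unit, inferInstance, (), fun _ _ => (), fun _ _ => p, rfl, fun _ _ => Iff.rfl⟩

theorem not (h : Automatic R) : Automatic fun v => ¬ R v := by
  obtain ⟨Q, hQ, q₀, δ, P, rfl, hP⟩ := h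
  exact ⟨Q, hQ, q₀, δ, fun q v => ¬ P q v, rfl, fun q v => not_congr (hP q v)⟩

/-- Product automaton: all components read the same digits independently. -/
theorem forall_finite [Finite κ] {R : κ → (ι → ℕ) → Prop} (h : ∀ k, Automatic (R k)) :
    Automatic fun v => ∀ k, R k v := by
  choose Q hQ q₀ δ P hP₀ hP using h
  refine ⟨∀ k, Q k, inferInstance, q₀, fun q b k => δ k (q k) b, fun q v => ∀ k, P k (q k) v,
    ?_, fun q v => forall_congr' fun k => hP k (q k) v⟩
  funext v
  simp only [hP₀]

theorem and (h : Automatic R) (h' : Automatic R') : Automatic fun v => R v ∧ R' v := by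
  have : Automatic fun v => ∀ b : Bool, (bif b then R else R') v :=
    forall_finite fun b => by cases b <;> assumption
  simpa [and_comm] using this

/-- The relation obtained by renaming arguments and substituting zero. -/
theorem comap (f : ι → Option κ) (h : Automatic R) :
    Automatic fun v : κ → ℕ => R fun i => (f i).elim 0 v := by
  obtain ⟨Q, hQ, q₀, δ, P, rfl, hP⟩ := h
  refine ⟨Q, hQ, q₀, fun q b => δ q fun i => (f i).elim false b,
    fun q v => P q fun i => (f i).elim 0 v, rfl, fun q v => ?_⟩
  beta_reduce
  rw [hP]
  have h₁ : (fun i => ((f i).elim 0 v).testBit 0) =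
      fun i => (f i).elim false fun i => (v i).testBit 0 := by
    funext i; cases f i <;> simp
  have h₂ : (fun i => (f i).elim 0 v / 2) = fun i => (f i).elim 0 fun i => v i / 2 := by
    funext i; cases f i <;> simp
  rw [h₁, h₂]

theorem eq_zero (i : ι) : Automatic fun v => v i = 0 := by
  refine ⟨Bool, inferInstance, true, fun q b => q && !b i, fun q v => q = true ∧ v i = 0,
    by simp, fun q v => ?_⟩
  cases q <;> simp
  omega

theorem eq (i j : ι) : Automatic fun v => v i = v j := by
  refine ⟨Bool, inferInstance, true, fun q b => q && b i == b j, fun q v => q = true ∧ v i = v j,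
    by simp, fun q v => ?_⟩
  cases q <;> simp
  omega

/-- The state is the verdict of the lower digits, used only if the higher parts agree; it enters the
invariant as the summand `q.toNat`. -/
theorem lt (i j : ι) : Automatic fun v => v i < v j := by
  refine ⟨Bool, inferInstance, false, fun q b => (!b i && b j) || (q && (b i == b j)),
    fun q v => v i < v j + q.toNat, by simp, fun q v => ?_⟩
  simp only [Nat.testBit_zero]
  rcases Nat.mod_two_eq_zero_or_one (v i) with h | h <;>
    rcases Nat.mod_two_eq_zero_or_one (v j) with h' | h' <;> cases q <;> simp [h, h'] <;> omega

theorem size_eq (n : ℕ) : n.size = if n = 0 then 0 else (n / 2).size + 1 := by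
  split
  · simp [*]
  · rename_i h
    conv_lhs => rw [← Nat.bit_testBit_zero_shiftRight_one n]
    rw [Nat.size_bit]
    · simp [Nat.shiftRight_one]
    · rwa [Nat.bit_testBit_zero_shiftRight_one]

/-- Being at most as long as another number. -/
theorem size_le (i j : ι) : Automatic fun v => (v i).size ≤ (v j).size := by
  -- State `false` is a pending obligation: a one of the first number has been read that no digit
  -- one of the second number, at the same or a higher place, has matched yet.
  refine ⟨Bool, inferInstance, true, fun q b => (!b i && q) || b j,
    fun q v => (v i).size ≤ (v j).size ∧ (q = false → v j ≠ 0), by simp, fun q v => ?_⟩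
  beta_reduce
  rw [size_eq (v i), size_eq (v j)]
  have h₀ : ∀ n : ℕ, n = 0 ↔ n.size = 0 := fun n => Nat.size_eq_zero.symm
  have hi := h₀ (v i / 2)
  have hj := h₀ (v j / 2)
  simp only [Nat.testBit_zero]
  rcases Nat.mod_two_eq_zero_or_one (v i) with h | h <;>
    rcases Nat.mod_two_eq_zero_or_one (v j) with h' | h' <;> cases q <;>
    simp [h, h'] <;> split <;> split <;> omega

/-- The `i`-th argument is the largest power of two that is at most the `j`-th argument. -/
theorem top (i j : ι) : Automatic fun v => v j ≠ 0 ∧ v i = 2 ^ (Nat.log 2 (v j)) := by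
  -- State 0 waits for the only one of `v i`, state 1 has seen it together with a one of `v j` and
  -- allows only zeros from then on, state 2 rejects.
  refine ⟨Fin 3, inferInstance, 0,
    fun q b => if q = 0 then (if b i then if b j then 1 else 2 else 0) else
      if q = 1 then (if b i || b j then 2 else 1) else 2,
    fun q v => if q = 0 then v j ≠ 0 ∧ v i = 2 ^ (Nat.log 2 (v j)) else
      if q = 1 then v i = 0 ∧ v j = 0 else False, by simp, fun q v => ?_⟩
  simp only [Nat.testBit_zero]
  have hlog : 2 ≤ v j → 2 ^ Nat.log 2 (v j) = 2 * 2 ^ Nat.log 2 (v j / 2) := fun h => by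
    rw [Nat.log_of_one_lt_of_le one_lt_two h, pow_succ']
  have hpos := Nat.one_le_two_pow (n := Nat.log 2 (v j / 2))
  have h1 : v j = 1 → 2 ^ Nat.log 2 (v j) = 1 := fun h => by simp [h]
  generalize 2 ^ Nat.log 2 (v j) = a at *
  generalize 2 ^ Nat.log 2 (v j / 2) = b at *
  rcases Nat.mod_two_eq_zero_or_one (v i) with h | h <;>
    rcases Nat.mod_two_eq_zero_or_one (v j) with h' | h' <;> fin_cases q <;> simp [h, h'] <;> omega

/-- Linear equations in a finite group. -/
theorem sum_nsmul_eq_zero [Fintype κ] {H : Type} [AddCommGroup H] [Finite H] (f : κ → ι)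
    (h : κ → H) : Automatic fun v => ∑ s, v (f s) • h s = 0 := by
  -- The state holds the partial sum and the coefficients, which double with every digit; finiteness
  -- of `H` bounds the number of states.
  refine ⟨H × (κ → H), inferInstance, (0, h),
    fun q b => (q.1 + ∑ s, (b (f s)).toNat • q.2 s, 2 • q.2),
    fun q v => q.1 + ∑ s, v (f s) • q.2 s = 0, by simp, fun q v => ?_⟩
  have : ∀ s, v (f s) • q.2 s =
      ((v (f s)).testBit 0).toNat • q.2 s + (v (f s) / 2) • 2 • q.2 s := by
    intro s
    rw [← mul_nsmul', ← add_nsmul, Nat.testBit_zero]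
    congr 1
    rcases Nat.mod_two_eq_zero_or_one (v (f s)) with h | h <;> simp [h] <;> omega
  simp only [this, Finset.sum_add_distrib, Pi.smul_apply, add_assoc]

/-- Linear equations over the integers. -/
theorem sum_mul_eq_zero [Fintype κ] (f : κ → ι) (c : κ → ℤ) :
    Automatic fun v => ∑ s, (v (f s) : ℤ) * c s = 0 := by
  -- The state is a carry. One digit of each argument adds at most `B` in absolute value, and
  -- halving then brings the carry back into `[-B, B]`.
  set B : ℤ := ∑ s, |c s|
  have hB : 0 ≤ B := Finset.sum_nonneg fun _ _ => abs_nonneg _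
  let r : Set.Icc (-B) B → (ι → Bool) → ℤ := fun z b => z + ∑ s, ((b (f s)).toNat : ℤ) * c s
  have hr : ∀ z b, r z b / 2 ∈ Set.Icc (-B) B := by
    intro z b
    have h : |∑ s, ((b (f s)).toNat : ℤ) * c s| ≤ B := by
      refine (Finset.abs_sum_le_sum_abs _ _).trans (Finset.sum_le_sum fun s _ => ?_)
      cases b (f s) <;> simp
    obtain ⟨h₁, h₂⟩ := z.2
    rw [abs_le] at h
    simp only [r, Set.mem_Icc]
    omega
  -- `none` rejects: an odd carry can never be cancelled by the higher digits.
  refine ⟨Option (Set.Icc (-B) B), inferInstance, some ⟨0, by simpa using hB⟩,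
    fun q b => q.bind fun z => if r z b % 2 = 0 then some ⟨r z b / 2, hr z b⟩ else none,
    fun q v => q.elim False fun z => (z : ℤ) + ∑ s, (v (f s) : ℤ) * c s = 0, by simp,
    fun q v => ?_⟩
  cases q with
  | none => simp
  | some z =>
    have h : ∑ s, (v (f s) : ℤ) * c s = ∑ s, (((v (f s)).testBit 0).toNat : ℤ) * c s +
        2 * ∑ s, ((v (f s) / 2 : ℕ) : ℤ) * c s := by
      rw [Finset.mul_sum, ← Finset.sum_add_distrib]
      refine Finset.sum_congr rfl fun s _ => ?_
      rw [← mul_assoc, ← add_mul, Nat.testBit_zero]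
      congr 1
      rcases Nat.mod_two_eq_zero_or_one (v (f s)) with h | h <;> simp [h] <;> omega
    have hrz : r z (fun i => (v i).testBit 0) = z + ∑ s, (((v (f s)).testBit 0).toNat : ℤ) * c s :=
      rfl
    simp only [Option.elim_some, Option.bind_some, h]
    rw [← add_assoc, ← hrz]
    generalize ∑ s, ((v (f s) / 2 : ℕ) : ℤ) * c s = y
    split
    · simp only [Option.elim_some]
      omega
    · simp only [Option.elim_none, iff_false]
      omega

/-- Linear equations in a finitely generated abelian group. -/
theorem prod_pow_eq_one {G : Type*} [CommGroup G] [Fintype κ] (f : κ → ι) (a : κ → G)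
    (ha : Submonoid.closure (Set.range a) = ⊤) :
    Automatic fun v => ∏ s, a s ^ v (f s) = 1 := by
  have : Monoid.FG G := ⟨(Set.finite_range a).toFinset, by simpa using ha⟩
  have : AddGroup.FG (Additive G) :=
    AddGroup.fg_iff_addMonoid_fg.2 (AddMonoid.fg_iff_mul_fg.2 this)
  -- In these coordinates the equation in `G` splits into `n` equations over ℤ and one in each
  -- finite cyclic summand.
  obtain ⟨n, J, _, p, hp, e, ⟨φ⟩⟩ := AddCommGroup.equiv_free_prod_directSum_zmod (Additive G)
  classical
  have hne : ∀ j, NeZero (p j ^ e j) := fun j => ⟨pow_ne_zero _ (hp j).ne_zero⟩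
  have key : ∀ v : ι → ℕ, ∏ s, a s ^ v (f s) = 1 ↔
      (∀ i : Fin n, ∑ s, (v (f s) : ℤ) * (φ (.ofMul (a s))).1 i = 0) ∧
      ∀ j : J, ∑ s, v (f s) • (φ (.ofMul (a s))).2 j = 0 := by
    intro v
    have h (j : J) : (∑ s, v (f s) • (φ (.ofMul (a s))).2) j =
        ∑ s, v (f s) • (φ (.ofMul (a s))).2 j :=
      (DFinsupp.finsetSum_apply ..).trans rfl
    rw [← ofMul_eq_zero, ← φ.map_eq_zero_iff, ofMul_prod, map_sum, Prod.ext_iff, Prod.fst_sum,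
      Prod.snd_sum, DFinsupp.ext_iff, Finsupp.ext_iff]
    simp only [ofMul_pow, map_nsmul, Prod.smul_snd, Prod.smul_fst, h]
    simp [Finsupp.finsetSum_apply]
  simp only [key]
  exact (forall_finite fun i => sum_mul_eq_zero f _).and
    (forall_finite fun j => sum_nsmul_eq_zero f _)

end Automatic

/-! ### Binary digits -/

theorem Nat.tail_bits (n : ℕ) : n.bits.tail = (n / 2).bits := by
  rw [← Nat.div2_bits_eq_tail, Nat.div2_val]

theorem Nat.drop_bits (w n : ℕ) : n.bits.drop w = (n / 2 ^ w).bits := by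
  induction w with
  | zero => simp
  | succ w ih => rw [← List.tail_drop, ih, Nat.tail_bits, Nat.div_div_eq_div_mul, pow_succ]

theorem Nat.getElem?_bits (n i : ℕ) : n.bits[i]?.getD false = n.testBit i := by
  rw [Nat.testBit_eq_inth, List.getI_eq_getElem?_getD]
  rfl

/-- The number whose binary digits are the digits of `g` at the places `c`, `w + c`, `2 * w + c`,
and so on. -/
def digitsAt (w g c : ℕ) : ℕ :=
  Nat.ofBits fun j : Fin g.size => g.testBit (w * j + c)

theorem testBit_digitsAt {w : ℕ} (hw : 0 < w) (g c j : ℕ) :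
    (digitsAt w g c).testBit j = g.testBit (w * j + c) := by
  by_cases h : j < g.size
  · exact Nat.testBit_ofBits_lt _ _ h
  · rw [digitsAt, Nat.testBit_ofBits_ge _ _ (not_lt.1 h), Nat.testBit_eq_false_of_lt]
    refine (Nat.lt_size_self g).trans_le (Nat.pow_le_pow_right two_pos ?_)
    nlinarith [not_lt.1 h]

/-- Removing one block of `w` digits from `g` removes the lowest digit of each interleaved number.
Reading `g` in blocks is thus reading all components digit by digit. -/
theorem digitsAt_div_two {w : ℕ} (hw : 0 < w) (g c : ℕ) :
    digitsAt w g c / 2 = digitsAt w (g / 2 ^ w) c := by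
  refine Nat.eq_of_testBit_eq fun j => ?_
  rw [Nat.testBit_div_two, testBit_digitsAt hw, testBit_digitsAt hw, Nat.testBit_div_two_pow]
  congr 1
  ring

theorem digitsAt_one (g : ℕ) : digitsAt 1 g 0 = g :=
  Nat.eq_of_testBit_eq fun j => by rw [testBit_digitsAt one_pos, one_mul, add_zero]

/-! ### Multi-stack machines -/

namespace Turing.TM2

/-- The machine goes from one configuration to another in exactly `n` steps. -/
def Runs {K : Type} [DecidableEq K] {Γ : K → Type} {Λ σ : Type} (M : Λ → Stmt Γ Λ σ) (n : ℕ)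
    (a b : Cfg Γ Λ σ) : Prop :=
  (flip bind (step M))^[n] (some a) = some b

section
variable {K : Type} [DecidableEq K] {Γ : K → Type} {Λ σ : Type} {M : Λ → Stmt Γ Λ σ}

theorem Runs.refl (a : Cfg Γ Λ σ) : Runs M 0 a a :=
  rfl

theorem Runs.trans {m n : ℕ} {a b c : Cfg Γ Λ σ} (h : Runs M m a b) (h' : Runs M n b c) :
    Runs M (m + n) a c := by
  rw [Runs, Nat.add_comm, Function.iterate_add_apply, h, h']

theorem Runs.head {n : ℕ} {a b c : Cfg Γ Λ σ} (h : step M a = some b) (h' : Runs M n b c) :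
    Runs M (n + 1) a c := by
  have : flip bind (step M) (some a) = some b := h
  rw [Runs, Function.iterate_succ_apply, this, h']

/-- Pop `w` letters from a stack. -/
def Stmt.pops (k : K) (f : ℕ → σ → Option (Γ k) → σ) : ℕ → Stmt Γ Λ σ → Stmt Γ Λ σ
  | 0, q => q
  | w + 1, q => pops k f w (.pop k (f w) q)

/-- The nesting of `pops` makes `f i` act on the letter at depth `i`. The whole block belongs to one
statement, so it does not cost extra steps. -/
theorem stepAux_pops (k : K) (f : ℕ → σ → Option (Γ k) → σ) (w : ℕ) (q : Stmt Γ Λ σ) (v : σ)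
    (S : ∀ k, List (Γ k)) :
    stepAux (Stmt.pops k f w q) v S =
      stepAux q (Nat.rec v (fun i v => f i v (S k)[i]?) w)
        (Function.update S k ((S k).drop w)) := by
  induction w generalizing q with
  | zero => simp [Stmt.pops]
  | succ w ih =>
    rw [Stmt.pops, ih]
    simp

end

end Turing.TM2

/-! ### The machine that answers questions on circuits -/

namespace Threshold

open Turing

variable {A : Type}

/-- The stacks of a machine that answers questions on circuits. -/
inductive Stack : Type
  | inp
  | tmpN
  | tmpG
  | numN
  | numG
  | out
  deriving DecidableEq

instance : Fintype Stack :=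
  ⟨{.inp, .tmpN, .tmpG, .numN, .numG, .out}, fun k => by cases k <;> simp⟩

/-- The stack alphabets. -/
abbrev StackAlphabet (A : Type) : Stack → Type
  | .inp => QuerySymbol A
  | _ => Bool

/-- The program labels. -/
inductive ProgLabel : Type
  | head
  | readN
  | readG
  | moveN
  | moveG
  | tags
  | loop
  deriving DecidableEq

instance : Fintype ProgLabel :=
  ⟨{.head, .readN, .readG, .moveN, .moveG, .tags, .loop}, fun l => by cases l <;> simp⟩

/-- The internal state: the kind of question, the letter read last, the digits read last, whether
something was read, and the state of an automaton. -/
structure ProgState (A : Type) (W : ℕ) (Q : Type) where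
  head : Option (QuerySymbol A)
  last : Option Bool
  digN : Bool
  digG : Fin W → Bool
  digH : Fin W → Bool
  any : Bool
  auto : Option Q

instance {W : ℕ} {Q : Type} [Finite A] [Finite Q] : Finite (ProgState A W Q) := by
  have := Fintype.ofFinite A
  refine Finite.of_injective (β := Option (QuerySymbol A) × Option Bool × Bool × (Fin W → Bool) ×
    (Fin W → Bool) × Bool × Option Q)
    (fun s => (s.head, s.last, s.digN, s.digG, s.digH, s.any, s.auto)) ?_
  rintro ⟨⟩ ⟨⟩ h
  simpa using h

/-- The digit denoted by a letter. -/
def QuerySymbol.digit? : QuerySymbol A → Option Bool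
  | .bit b => some b
  | _ => none

/-- The number of digits of the third number of a question that are read at once. -/
def QuerySymbol.width (W : ℕ) : QuerySymbol A → ℕ
  | .input _ => 1
  | _ => W

def QuerySymbol.isInput : QuerySymbol A → Bool
  | .input _ => true
  | _ => false

def QuerySymbol.isChild : QuerySymbol A → Bool
  | .child => true
  | _ => false

section Program

variable {W : ℕ} {Q : Type}

/-- The initial state. -/
def ProgState.init : ProgState A W Q :=
  ⟨none, none, false, fun _ => false, fun _ => false, false, none⟩

/-- Store the `i`-th digit of a block of the gate number. -/
def ProgState.setG (i : ℕ) (s : ProgState A W Q) (o : Option Bool) : ProgState A W Q :=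
  { s with digG := fun c => if c = i then o.getD false else s.digG c, any := s.any || o.isSome }

/-- Store the `i`-th digit of a block of the third number. -/
def ProgState.setH (i : ℕ) (s : ProgState A W Q) (o : Option (QuerySymbol A)) :
    ProgState A W Q :=
  { s with
    digH := fun c => if c = i then (o.bind QuerySymbol.digit?).getD false else s.digH c,
    any := s.any || o.isSome }

/-- A machine that splits a question into its parts and runs an automaton on the numbers. -/
def program (start : QuerySymbol A → (Fin W → Bool) → (Fin W → Bool) → Q)
    (δ : Q → Bool → (Fin W → Bool) → (Fin W → Bool) → Q) (acc : Q → Bool) :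
    ProgLabel → TM2.Stmt (StackAlphabet A) ProgLabel (ProgState A W Q)
  | .head => .pop .inp (fun s o => { s with head := o }) <| .goto fun _ => .readN
  | .readN =>
    .pop .inp (fun s o =>
      { s with last := (show Option (QuerySymbol A) from o).bind QuerySymbol.digit? }) <|
    .branch (fun s => s.last.isSome)
      (.push .tmpN (fun s => s.last.getD false) <| .goto fun _ => .readN)
      (.goto fun _ => .readG)
  | .readG =>
    .pop .inp (fun s o =>
      { s with last := (show Option (QuerySymbol A) from o).bind QuerySymbol.digit? }) <|
    .branch (fun s => s.last.isSome)
      (.push .tmpG (fun s => s.last.getD false) <| .goto fun _ => .readG)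
      (.goto fun _ => .moveN)
  -- Reading onto a stack reversed the digits; this second transfer puts the least significant one
  -- on top again, so that all three numbers can be read in parallel.
  | .moveN =>
    .pop .tmpN (fun s o => { s with last := o }) <|
    .branch (fun s => s.last.isSome)
      (.push .numN (fun s => s.last.getD false) <| .goto fun _ => .moveN)
      (.goto fun _ => .moveG)
  | .moveG =>
    .pop .tmpG (fun s o => { s with last := o }) <|
    .branch (fun s => s.last.isSome)
      (.push .numG (fun s => s.last.getD false) <| .goto fun _ => .moveG)
      (.goto fun _ => .tags)
  -- The first `W` digits of a gate number are the code of its node and go into the finite state;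
  -- only a child question has a second gate number to strip.
  | .tags =>
    .pops .numG ProgState.setG W <|
    .branch (fun s => (s.head.map QuerySymbol.isChild).getD false)
      (.pops .inp ProgState.setH W <|
        .load (fun s =>
            { s with any := false, auto := s.head.map fun h => start h s.digG s.digH }) <|
        .goto fun _ => .loop)
      (.load (fun s =>
            { s with any := false, auto := s.head.map fun h => start h s.digG s.digH }) <|
        .goto fun _ => .loop)
  | .loop =>
    .load (fun s => { s with digH := fun _ => false, any := false }) <|
    .pop .numN (fun s (o : Option Bool) => { s with digN := o.getD false, any := o.isSome }) <|
    .pops .numG ProgState.setG W <|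
    .branch (fun s => (s.head.map QuerySymbol.isInput).getD false)
      (.pops .inp ProgState.setH 1 <|
        .branch (fun s => s.any)
          (.load (fun s => { s with auto := s.auto.map fun q => δ q s.digN s.digG s.digH }) <|
            .goto fun _ => .loop)
          (.push .out (fun s => (s.auto.map acc).getD false) <|
            -- A halting configuration in the sense of `haltList` has the initial internal state.
            .load (fun _ => .init) <| .halt))
      (.pops .inp ProgState.setH W <|
        .branch (fun s => s.any)
          (.load (fun s => { s with auto := s.auto.map fun q => δ q s.digN s.digG s.digH }) <|
            .goto fun _ => .loop)
          (.push .out (fun s => (s.auto.map acc).getD false) <|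
            .load (fun _ => .init) <| .halt))

/-- The contents of all stacks. -/
def stackContents (i : List (QuerySymbol A)) (tn tg n g o : List Bool) :
    ∀ k, List (StackAlphabet A k)
  | .inp => i
  | .tmpN => tn
  | .tmpG => tg
  | .numN => n
  | .numG => g
  | .out => o

section
variable (i i' : List (QuerySymbol A)) (tn tg n g o l : List Bool)

@[simp] theorem stackContents_inp : stackContents i tn tg n g o .inp = i := rfl
@[simp] theorem stackContents_tmpN : stackContents i tn tg n g o .tmpN = tn := rfl
@[simp] theorem stackContents_tmpG : stackContents i tn tg n g o .tmpG = tg := rfl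
@[simp] theorem stackContents_numN : stackContents i tn tg n g o .numN = n := rfl
@[simp] theorem stackContents_numG : stackContents i tn tg n g o .numG = g := rfl
@[simp] theorem stackContents_out : stackContents i tn tg n g o .out = o := rfl

@[simp] theorem update_stackContents_inp :
    Function.update (stackContents i tn tg n g o) .inp i' = stackContents i' tn tg n g o := by
  funext k; cases k <;> rfl
@[simp] theorem update_stackContents_tmpN :
    Function.update (stackContents i tn tg n g o) .tmpN l = stackContents i l tg n g o := by
  funext k; cases k <;> rfl
@[simp] theorem update_stackContents_tmpG :
    Function.update (stackContents i tn tg n g o) .tmpG l = stackContents i tn l n g o := by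
  funext k; cases k <;> rfl
@[simp] theorem update_stackContents_numN :
    Function.update (stackContents i tn tg n g o) .numN l = stackContents i tn tg l g o := by
  funext k; cases k <;> rfl
@[simp] theorem update_stackContents_numG :
    Function.update (stackContents i tn tg n g o) .numG l = stackContents i tn tg n l o := by
  funext k; cases k <;> rfl
@[simp] theorem update_stackContents_out :
    Function.update (stackContents i tn tg n g o) .out l = stackContents i tn tg n g l := by
  funext k; cases k <;> rfl

end

theorem rec_setG (s : ProgState A W Q) (l : List Bool) (w : ℕ) :
    (Nat.rec s (fun i v => ProgState.setG i v l[i]?) w : ProgState A W Q) =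
      { s with
        digG := fun c => if c < w then l[(c : ℕ)]?.getD false else s.digG c,
        any := s.any || (w != 0 && !l.isEmpty) } := by
  induction w with
  | zero => simp
  | succ w ih =>
    change ProgState.setG w (Nat.rec s _ w) _ = _
    rw [ih]
    simp only [ProgState.setG, ProgState.mk.injEq, true_and, and_true]
    refine ⟨?_, ?_⟩
    · funext c
      by_cases h : (c : ℕ) = w
      · simp [h]
      · simp [h, Nat.le_iff_lt_or_eq]
    · cases l <;> cases w <;> simp

theorem rec_setH (s : ProgState A W Q) (l : List (QuerySymbol A)) (w : ℕ) :
    (Nat.rec s (fun i v => ProgState.setH i v l[i]?) w : ProgState A W Q) =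
      { s with
        digH := fun c => if c < w then (l[(c : ℕ)]?.bind QuerySymbol.digit?).getD false
          else s.digH c,
        any := s.any || (w != 0 && !l.isEmpty) } := by
  induction w with
  | zero => simp
  | succ w ih =>
    change ProgState.setH w (Nat.rec s _ w) _ = _
    rw [ih]
    simp only [ProgState.setH, ProgState.mk.injEq, true_and, and_true]
    refine ⟨?_, ?_⟩
    · funext c
      by_cases h : (c : ℕ) = w
      · simp [h]
      · simp [h, Nat.le_iff_lt_or_eq]
    · cases l <;> cases w <;> simp

end Program

end Threshold

/-! ### Correctness and running time of the machine -/

namespace Threshold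

open Turing Turing.TM2

variable {A : Type}

section Program

variable {W : ℕ} {Q : Type} (start : QuerySymbol A → (Fin W → Bool) → (Fin W → Bool) → Q)
  (δ : Q → Bool → (Fin W → Bool) → (Fin W → Bool) → Q) (acc : Q → Bool)

theorem runs_readN (v : ProgState A W Q) (l : List Bool) (i : List (QuerySymbol A))
    (tn tg n g o : List Bool) :
    Runs (program start δ acc) (l.length + 1)
      ⟨some .readN, v, stackContents (l.map .bit ++ .sep :: i) tn tg n g o⟩
      ⟨some .readG, { v with last := none }, stackContents i (l.reverse ++ tn) tg n g o⟩ := by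
  induction l generalizing v tn with
  | nil => exact Runs.head (by simp [program, QuerySymbol.digit?]) (Runs.refl _)
  | cons b l ih =>
    refine Runs.head (b := ⟨some .readN, { v with last := some b },
      stackContents (l.map .bit ++ .sep :: i) (b :: tn) tg n g o⟩) ?_ ?_
    · simp [program, QuerySymbol.digit?]
    · simpa using ih { v with last := some b } (b :: tn)

theorem runs_readG (v : ProgState A W Q) (l : List Bool) (i : List (QuerySymbol A))
    (tn tg n g o : List Bool) :
    Runs (program start δ acc) (l.length + 1)
      ⟨some .readG, v, stackContents (l.map .bit ++ .sep :: i) tn tg n g o⟩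
      ⟨some .moveN, { v with last := none }, stackContents i tn (l.reverse ++ tg) n g o⟩ := by
  induction l generalizing v tg with
  | nil => exact Runs.head (by simp [program, QuerySymbol.digit?]) (Runs.refl _)
  | cons b l ih =>
    refine Runs.head (b := ⟨some .readG, { v with last := some b },
      stackContents (l.map .bit ++ .sep :: i) tn (b :: tg) n g o⟩) ?_ ?_
    · simp [program, QuerySymbol.digit?]
    · simpa using ih { v with last := some b } (b :: tg)

theorem runs_moveN (v : ProgState A W Q) (i : List (QuerySymbol A)) (l tg n g o : List Bool) :
    Runs (program start δ acc) (l.length + 1)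
      ⟨some .moveN, v, stackContents i l tg n g o⟩
      ⟨some .moveG, { v with last := none }, stackContents i [] tg (l.reverse ++ n) g o⟩ := by
  induction l generalizing v n with
  | nil => exact Runs.head (by simp [program]) (Runs.refl _)
  | cons b l ih =>
    refine Runs.head (b := ⟨some .moveN, { v with last := some b },
      stackContents i l tg (b :: n) g o⟩) ?_ ?_
    · simp [program]
    · simpa using ih { v with last := some b } (b :: n)

theorem runs_moveG (v : ProgState A W Q) (i : List (QuerySymbol A)) (tn l n g o : List Bool) :
    Runs (program start δ acc) (l.length + 1)
      ⟨some .moveG, v, stackContents i tn l n g o⟩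
      ⟨some .tags, { v with last := none }, stackContents i tn [] n (l.reverse ++ g) o⟩ := by
  induction l generalizing v g with
  | nil => exact Runs.head (by simp [program]) (Runs.refl _)
  | cons b l ih =>
    refine Runs.head (b := ⟨some .moveG, { v with last := some b },
      stackContents i tn l n (b :: g) o⟩) ?_ ?_
    · simp [program]
    · simpa using ih { v with last := some b } (b :: g)

/-- The digits of a number on top of the input stack. -/
theorem digit?_getElem? (l : List Bool) {tail : List (QuerySymbol A)}
    (ht : ∀ s ∈ tail, s.digit? = none) (c : ℕ) :
    ((l.map .bit ++ tail)[c]?.bind QuerySymbol.digit?).getD false = l[c]?.getD false := by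
  by_cases hc : c < l.length
  · simp [List.getElem?_append_left, hc, QuerySymbol.digit?]
  · rw [List.getElem?_append_right (by simpa using hc), List.getElem?_eq_none (not_lt.1 hc)]
    cases h : tail[c - (l.map QuerySymbol.bit).length]? with
    | none => rfl
    | some s => simp [ht s (List.mem_of_getElem? h)]

theorem stepAux_pops_setG (v : ProgState A W Q) (i : List (QuerySymbol A))
    (tn tg n g o : List Bool) (w : ℕ) (q : Stmt (StackAlphabet A) ProgLabel (ProgState A W Q)) :
    stepAux (.pops .numG ProgState.setG w q) v (stackContents i tn tg n g o) =
      stepAux q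
        { v with
          digG := fun c => if c < w then g[(c : ℕ)]?.getD false else v.digG c
          any := v.any || (w != 0 && !g.isEmpty) }
        (stackContents i tn tg n (g.drop w) o) := by
  rw [stepAux_pops, update_stackContents_numG, stackContents_numG, rec_setG]

theorem stepAux_pops_setH (v : ProgState A W Q) (i : List (QuerySymbol A))
    (tn tg n g o : List Bool) (w : ℕ) (q : Stmt (StackAlphabet A) ProgLabel (ProgState A W Q)) :
    stepAux (.pops .inp ProgState.setH w q) v (stackContents i tn tg n g o) =
      stepAux q
        { v with
          digH := fun c => if c < w then (i[(c : ℕ)]?.bind QuerySymbol.digit?).getD false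
            else v.digH c
          any := v.any || (w != 0 && !i.isEmpty) }
        (stackContents (i.drop w) tn tg n g o) := by
  rw [stepAux_pops, update_stackContents_inp, stackContents_inp, rec_setH]

/-- An exhausted stack delivers `false`, which pads the shorter numbers with leading zeros; the
machine stops only when all three stacks were empty before the round. -/
theorem step_loop {hd : QuerySymbol A} {v : ProgState A W Q} {q : Q} (hv : v.head = some hd)
    (hq : v.auto = some q) (lh : List (QuerySymbol A)) (ln lg : List Bool) (hW : 0 < W) :
    (ln = [] ∧ lg = [] ∧ lh = [] ∧
      step (program start δ acc) ⟨some .loop, v, stackContents lh [] [] ln lg []⟩ =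
        some ⟨none, .init, stackContents [] [] [] [] [] [acc q]⟩) ∨
    (¬ (ln = [] ∧ lg = [] ∧ lh = []) ∧ ∃ v' : ProgState A W Q, v'.head = some hd ∧
      v'.auto = some (δ q (ln[0]?.getD false) (fun c => lg[(c : ℕ)]?.getD false) fun c =>
        if c < hd.width W then (lh[(c : ℕ)]?.bind QuerySymbol.digit?).getD false else false) ∧
      step (program start δ acc) ⟨some .loop, v, stackContents lh [] [] ln lg []⟩ =
        some ⟨some .loop, v',
          stackContents (lh.drop (hd.width W)) [] [] (ln.drop 1) (lg.drop W) []⟩) := by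
  have hw : hd.width W = if hd.isInput then 1 else W := by cases hd <;> rfl
  have hW' : W ≠ 0 := hW.ne'
  by_cases h : ln = [] ∧ lg = [] ∧ lh = []
  · left
    obtain ⟨rfl, rfl, rfl⟩ := h
    refine ⟨rfl, rfl, rfl, ?_⟩
    cases hi : hd.isInput <;>
      simp [program, stepAux_pops_setG, stepAux_pops_setH, hv, hi, hq]
  · right
    refine ⟨h, { v with
      digN := ln[0]?.getD false
      digG := fun c => lg[(c : ℕ)]?.getD false
      digH := fun c =>
        if c < hd.width W then (lh[(c : ℕ)]?.bind QuerySymbol.digit?).getD false else false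
      any := true
      auto := some (δ q (ln[0]?.getD false) (fun c => lg[(c : ℕ)]?.getD false) fun c =>
        if c < hd.width W then (lh[(c : ℕ)]?.bind QuerySymbol.digit?).getD false else false) },
      hv, rfl, ?_⟩
    have hany : (ln[0]?.isSome || W != 0 && !lg.isEmpty || !lh.isEmpty) = true := by
      by_contra hcon
      simp only [Bool.not_eq_true, Bool.or_eq_false_iff, ← List.head?_eq_getElem?] at hcon
      exact h (by simpa [and_assoc, hW'] using hcon)
    have hWb : (W != 0) = true := by simpa using hW'
    cases hi : hd.isInput <;> rw [hi] at hw <;>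
      simp only [program, step, stepAux, stepAux_pops_setG, stepAux_pops_setH, hv, hi, hq, hw, hWb,
        List.head?_eq_getElem?, Bool.true_and, update_stackContents_numN, stackContents_numN,
        Option.map_some, Option.getD_some, cond_true, cond_false, if_true, Fin.is_lt] at hany ⊢ <;>
      simp [hany]

-- `P` is the invariant: `hP` carries it through a round, and `hacc` evaluates it when only zeros
-- are left. Each round shortens some nonempty stack, so the total stack length bounds the number of
-- rounds.
open Classical in
theorem runs_loop {hd : QuerySymbol A} {P : Q → ℕ → ℕ → ℕ → Prop} (hW : 0 < W)
    (hP : ∀ q n g h, P q n g h ↔ P (δ q (n.testBit 0) (fun c => g.testBit c)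
      fun c => if c < hd.width W then h.testBit c else false)
      (n / 2) (g / 2 ^ W) (h / 2 ^ hd.width W))
    (hacc : ∀ q, acc q = true ↔ P q 0 0 0) {N : ℕ} (q : Q) (n g h : ℕ)
    (tail : List (QuerySymbol A)) (ht : ∀ s ∈ tail, s.digit? = none) (v : ProgState A W Q)
    (hN : n.bits.length + g.bits.length + h.bits.length + tail.length ≤ N)
    (hv : v.head = some hd) (hq : v.auto = some q) :
    ∃ k ≤ N + 1, Runs (program start δ acc) k
      ⟨some .loop, v, stackContents (h.bits.map .bit ++ tail) [] [] n.bits g.bits []⟩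
      ⟨none, .init, stackContents [] [] [] [] [] [decide (P q n g h)]⟩ := by
  have hw : 0 < hd.width W := by cases hd <;> simp [QuerySymbol.width, hW]
  induction N using Nat.strong_induction_on generalizing q n g h tail v with
  | _ N ih =>
  rcases step_loop start δ acc hv hq (h.bits.map .bit ++ tail) n.bits g.bits hW with
    ⟨hn, hg, hh, hs⟩ | ⟨hne, v', hv', hq', hs⟩
  · have hz : ∀ m : ℕ, m.bits = [] → m = 0 := fun m hm =>
      Nat.size_eq_zero.1 (by rw [← Nat.size_eq_bits_len, hm]; rfl)
    rw [List.append_eq_nil_iff, List.map_eq_nil_iff] at hh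
    refine ⟨1, by omega, Runs.head hs ?_⟩
    obtain rfl := hz _ hn
    obtain rfl := hz _ hg
    obtain rfl := hz _ hh.1
    rw [Bool.eq_iff_iff.2 ((hacc q).trans decide_eq_true_iff.symm)]
    exact Runs.refl _
  · have hlen : (n.bits.drop 1).length + (g.bits.drop W).length +
        ((h.bits.map QuerySymbol.bit ++ tail).drop (hd.width W) :
          List (QuerySymbol A)).length < N := by
      rw [← List.length_eq_zero_iff, ← List.length_eq_zero_iff, ← List.length_eq_zero_iff,
        List.length_append, List.length_map] at hne
      simp only [List.length_drop, List.length_append, List.length_map]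
      omega
    rw [List.drop_append, ← List.map_drop, Nat.drop_bits, Nat.drop_bits, Nat.drop_bits, pow_one]
      at hlen hs
    obtain ⟨k, hk, hr⟩ := ih _ hlen _ _ _ _ _
      (fun s hs => ht s (List.mem_of_mem_drop hs)) v'
      (by rw [List.length_append, List.length_map, ← add_assoc]) hv' hq'
    refine ⟨k + 1, by omega, Runs.head hs ?_⟩
    simp only [digit?_getElem? _ ht, Nat.getElem?_bits, ← hP] at hr
    exact hr

end Program

end Threshold

/-! ### The parts of a question -/

namespace Threshold

open Turing Turing.TM2

variable {A : Type}

/-- The letter that tells the kind of a question. -/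
def Query.symbol : Query A → QuerySymbol A
  | .input _ _ s => .input s
  | .inner _ o => .inner o
  | .child _ _ => .child
  | .output _ => .output

/-- The gate that a question is about. -/
def Query.gate : Query A → ℕ
  | .input g _ _ => g
  | .inner g _ => g
  | .child g _ => g
  | .output g => g

/-- The second number of a question. -/
def Query.arg : Query A → ℕ
  | .input _ i _ => i
  | .child _ h => h
  | _ => 0

/-- The first block of digits of the number of the child. -/
def Query.argTag (W : ℕ) : Query A → Fin W → Bool
  | .child _ h => fun c => h.testBit c
  | _ => fun _ => false

/-- The second number of a question without its first block of digits in case of a gate number. -/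
def Query.argRest (W : ℕ) : Query A → ℕ
  | .child _ h => h / 2 ^ W
  | q => q.arg

/-- The separator that closes the second number of a question. -/
def Query.tail : Query A → List (QuerySymbol A)
  | .input _ _ _ => [.sep]
  | .child _ _ => [.sep]
  | _ => []

theorem encodeQuery_eq (n : ℕ) (q : Query A) :
    encodeQuery (n, q) = q.symbol :: (n.bits.map .bit ++ .sep ::
      (q.gate.bits.map .bit ++ .sep :: (q.arg.bits.map .bit ++ q.tail))) := by
  cases q <;> simp [encodeQuery, encodeNumbers, Query.symbol, Query.gate, Query.arg, Query.tail]

section Program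

variable {W : ℕ} {Q : Type} (start : QuerySymbol A → (Fin W → Bool) → (Fin W → Bool) → Q)
  (δ : Q → Bool → (Fin W → Bool) → (Fin W → Bool) → Q) (acc : Q → Bool)

theorem step_tags (p : Query A) (n : ℕ) {v : ProgState A W Q} (hv : v.head = some p.symbol)
    (hv' : v.digH = fun _ => false) :
    ∃ (v' : ProgState A W Q) (tail : List (QuerySymbol A)),
      v'.head = some p.symbol ∧
      v'.auto = some (start p.symbol (fun c => p.gate.testBit c) (p.argTag W)) ∧
      tail.length ≤ p.tail.length ∧ (∀ s ∈ tail, s.digit? = none) ∧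
      step (program start δ acc) ⟨some .tags, v,
        stackContents (p.arg.bits.map .bit ++ p.tail) [] [] n.bits p.gate.bits []⟩ =
      some ⟨some .loop, v', stackContents ((p.argRest W).bits.map .bit ++ tail) [] [] n.bits
        (p.gate / 2 ^ W).bits []⟩ := by
  have ht : ∀ s ∈ p.tail, s.digit? = none := by
    cases p <;> simp [Query.tail, QuerySymbol.digit?]
  let v' : ProgState A W Q := { v with
    digG := fun c => p.gate.testBit c
    digH := p.argTag W
    any := false
    auto := some (start p.symbol (fun c => p.gate.testBit c) (p.argTag W)) }
  by_cases hc : p.symbol.isChild = true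
  -- If the child number has fewer than `W` digits, popping its code also consumes the separator.
  · refine ⟨v', p.tail.drop (W - p.arg.bits.length), hv, rfl, by simp,
      fun s hs => ht s (List.mem_of_mem_drop hs), ?_⟩
    have h₁ : p.argTag W = fun c : Fin W => p.arg.testBit c := by
      cases p <;> first | rfl | cases hc
    have h₂ : p.argRest W = p.arg / 2 ^ W := by
      cases p <;> first | rfl | cases hc
    simp [program, stepAux_pops_setG, stepAux_pops_setH, hv, hc, List.drop_append,
      ← List.map_drop, Nat.drop_bits, v', h₁, h₂, Nat.getElem?_bits, digit?_getElem? _ ht]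
  · refine ⟨v', p.tail, hv, rfl, le_rfl, ht, ?_⟩
    have h₁ : p.argTag W = fun _ => false := by
      cases p <;> first | rfl | exact absurd rfl hc
    have h₂ : p.argRest W = p.arg := by
      cases p <;> first | rfl | exact absurd rfl hc
    simp [program, stepAux_pops_setG, hv, hv', hc, Nat.drop_bits, v', h₁, h₂, Nat.getElem?_bits]

open Classical in
theorem runs_program {P : QuerySymbol A → Q → ℕ → ℕ → ℕ → Prop} (hW : 0 < W)
    (hP : ∀ hd q n g h, P hd q n g h ↔ P hd (δ q (n.testBit 0) (fun c => g.testBit c)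
      fun c => if c < hd.width W then h.testBit c else false)
      (n / 2) (g / 2 ^ W) (h / 2 ^ hd.width W))
    (hacc : ∀ hd q, acc q = true ↔ P hd q 0 0 0) (n : ℕ) (p : Query A) :
    ∃ k ≤ 10 * ((encodeQuery (n, p)).length + 1), Runs (program start δ acc) k
      ⟨some .head, .init, stackContents (encodeQuery (n, p)) [] [] [] [] []⟩
      ⟨none, .init, stackContents [] [] [] [] []
        [decide (P p.symbol (start p.symbol (fun c => p.gate.testBit c) (p.argTag W)) n
          (p.gate / 2 ^ W) (p.argRest W))]⟩ := by
  let v : ProgState A W Q := { (ProgState.init : ProgState A W Q) with head := some p.symbol }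
  obtain ⟨v', tail, h₁, h₂, h₃, h₄, hs⟩ := step_tags start δ acc p n (v := v) rfl rfl
  obtain ⟨k, hk, hr⟩ := runs_loop start δ acc hW (hP p.symbol) (hacc p.symbol) _ n (p.gate / 2 ^ W)
    (p.argRest W) tail h₄ v' le_rfl h₁ h₂
  have r₁ := runs_readN start δ acc v n.bits
    (p.gate.bits.map .bit ++ .sep :: (p.arg.bits.map .bit ++ p.tail)) [] [] [] [] []
  have r₂ := runs_readG start δ acc v p.gate.bits (p.arg.bits.map .bit ++ p.tail)
    (n.bits.reverse ++ []) [] [] [] []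
  have r₃ := runs_moveN start δ acc v (p.arg.bits.map .bit ++ p.tail)
    (n.bits.reverse ++ []) (p.gate.bits.reverse ++ []) [] [] []
  have r₄ := runs_moveG start δ acc v (p.arg.bits.map .bit ++ p.tail) []
    (p.gate.bits.reverse ++ []) n.bits [] []
  simp only [List.append_nil, List.reverse_reverse] at r₁ r₂ r₃ r₄
  refine ⟨_, ?_, Runs.head (b := ⟨some .readN, v, stackContents (n.bits.map .bit ++ .sep ::
      (p.gate.bits.map .bit ++ .sep :: (p.arg.bits.map .bit ++ p.tail))) [] [] [] [] []⟩) ?_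
    (r₁.trans (r₂.trans (r₃.trans (r₄.trans (Runs.head hs hr)))))⟩
  · have e₁ : (p.gate / 2 ^ W).bits.length ≤ p.gate.bits.length := by
      rw [← Nat.drop_bits]; simp
    have e₂ : (p.argRest W).bits.length ≤ p.arg.bits.length := by
      cases p <;> simp only [Query.argRest, Query.arg, ← Nat.drop_bits] <;> simp
    rw [encodeQuery_eq]
    simp only [List.length_cons, List.length_append, List.length_map, List.length_reverse]
    omega
  · rw [encodeQuery_eq]
    simp [program, v]

end Program

/-- A question that can be answered by a finite automaton that reads its numbers digit by digit can
be answered in linear time. -/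
theorem exists_linear_time {W : ℕ} {Q : Type} [Finite A] [Finite Q]
    (start : QuerySymbol A → (Fin W → Bool) → (Fin W → Bool) → Q)
    (δ : Q → Bool → (Fin W → Bool) → (Fin W → Bool) → Q)
    {P : QuerySymbol A → Q → ℕ → ℕ → ℕ → Prop} (hW : 0 < W)
    (hP : ∀ hd q n g h, P hd q n g h ↔ P hd (δ q (n.testBit 0) (fun c => g.testBit c)
      fun c => if c < hd.width W then h.testBit c else false)
      (n / 2) (g / 2 ^ W) (h / 2 ^ hd.width W))
    (hacc : ∀ hd hd' q, P hd q 0 0 0 ↔ P hd' q 0 0 0) (f : ℕ × Query A → Bool)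
    (hf : ∀ n p, f (n, p) = true ↔ P p.symbol
      (start p.symbol (fun c => p.gate.testBit c) (p.argTag W)) n (p.gate / 2 ^ W)
      (p.argRest W)) :
    ∃ M : Turing.TM2ComputableInTime encodeQuery Computability.encodeBool f,
      (∀ k, Finite (M.tm.Γ k)) ∧ ∃ c : ℕ, ∀ l : ℕ, M.time l ≤ c * (l + 1) := by
  classical
  have := Fintype.ofFinite A
  have := Fintype.ofFinite (ProgState A W Q)
  -- The choice of `.child` is arbitrary: by `hacc` the verdict at zero does not depend on the kind
  -- of question.
  let acc : Q → Bool := fun q => decide (P .child q 0 0 0)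
  have hr := runs_program start δ acc hW hP
    (fun hd q => by rw [decide_eq_true_iff]; exact hacc _ _ _)
  let tm : FinTM2 :=
    { K := Stack
      k₀ := .inp
      k₁ := .out
      Γ := StackAlphabet A
      Λ := ProgLabel
      main := .head
      σ := ProgState A W Q
      initialState := .init
      m := program start δ acc }
  refine ⟨{ tm := tm
            inputAlphabet := Equiv.refl _
            outputAlphabet := Equiv.refl _
            time := fun l => 10 * (l + 1)
            outputsFun := fun a =>
              { steps := (hr a.1 a.2).choose
                evals_in_steps := ?_
                steps_le_m := (hr a.1 a.2).choose_spec.1 } }, ?_, 10, fun l => le_rfl⟩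
  · obtain ⟨n, p⟩ := a
    have h := (hr n p).choose_spec.2
    have h₁ : initList tm (encodeQuery (n, p)) =
        ⟨some .head, .init, stackContents (encodeQuery (n, p)) [] [] [] [] []⟩ := by
      refine congrArg _ (funext fun k => ?_)
      cases k <;> rfl
    have h₂ : haltList tm [f (n, p)] =
        ⟨none, .init, stackContents [] [] [] [] [] [f (n, p)]⟩ := by
      refine congrArg _ (funext fun k => ?_)
      cases k <;> rfl
    have h₃ := Bool.eq_iff_iff.2 ((hf n p).trans decide_eq_true_iff.symm)
    change _ = some (haltList tm (List.map id [f (n, p)]))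
    rw [List.map_id, h₂, h₃]
    change (flip bind _)^[_] (some (initList tm (List.map id (encodeQuery (n, p))))) = _
    rw [List.map_id, h₁]
    exact h
  · intro k
    change Finite (StackAlphabet A k)
    cases k <;> dsimp only [StackAlphabet] <;> infer_instance

end Threshold

/-! ### From automatic relations to linear time -/

namespace Threshold

variable {A : Type}

/-- The first `w` numbers that are interleaved in `g`, followed by zeros. -/
def unzip (w g c : ℕ) : ℕ :=
  if c < w then digitsAt w g c else 0

theorem testBit_unzip (w g c j : ℕ) :
    (unzip w g c).testBit j = if c < w then g.testBit (w * j + c) else false := by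
  unfold unzip
  split
  · exact testBit_digitsAt (by omega) _ _ _
  · simp

theorem unzip_div_two (w g c : ℕ) : unzip w g c / 2 = unzip w (g / 2 ^ w) c := by
  unfold unzip
  split
  · exact digitsAt_div_two (by omega) _ _
  · simp

theorem unzip_zero (w : ℕ) : unzip w 0 = 0 :=
  funext fun c => Nat.eq_of_testBit_eq fun j => by simp [testBit_unzip]

/-- The numbers in a question. -/
def queryNumbers (n : ℕ) (e e' : ℕ → ℕ) : Option (ℕ ⊕ ℕ) → ℕ :=
  fun i => i.elim n (Sum.elim e e')

/-- Questions are answered in linear time if the answers are automatic relations between the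
interleaved numbers. -/
theorem exists_linear_time_of_automatic [Finite A] {W : ℕ} (hW : 0 < W)
    (R : QuerySymbol A → (Fin W → Bool) → (Fin W → Bool) → (Option (ℕ ⊕ ℕ) → ℕ) → Prop)
    (hR : ∀ hd t t', Automatic (R hd t t')) (f : ℕ × Query A → Bool)
    (hf : ∀ n p, f (n, p) = true ↔ R p.symbol (fun c => p.gate.testBit c) (p.argTag W)
      (queryNumbers n (unzip W (p.gate / 2 ^ W)) (unzip (p.symbol.width W) (p.argRest W)))) :
    ∃ M : Turing.TM2ComputableInTime encodeQuery Computability.encodeBool f,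
      (∀ k, Finite (M.tm.Γ k)) ∧ ∃ c : ℕ, ∀ l : ℕ, M.time l ≤ c * (l + 1) := by
  choose Q hQ q₀ δ P hP₀ hP using hR
  have := Fintype.ofFinite A
  let ext : (Fin W → Bool) → ℕ → Bool := fun b c => if h : c < W then b ⟨c, h⟩ else false
  -- There is one automaton for each kind of question and each pair of codes. Their disjoint union
  -- is finite, and `start` enters the right one.
  refine exists_linear_time
    (Q := Σ i : QuerySymbol A × (Fin W → Bool) × (Fin W → Bool), Q i.1 i.2.1 i.2.2)
    (fun hd t t' => ⟨(hd, t, t'), q₀ hd t t'⟩)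
    (fun q b bg bh => ⟨q.1, δ _ _ _ q.2 fun i => i.elim b (Sum.elim (ext bg) (ext bh))⟩)
    (P := fun hd q n g h => P _ _ _ q.2 (queryNumbers n (unzip W g) (unzip (hd.width W) h)))
    hW ?_ ?_ f ?_
  · intro hd q n g h
    have hw : hd.width W ≤ W := by cases hd <;> simp [QuerySymbol.width] <;> omega
    dsimp only
    rw [hP]
    refine iff_of_eq (congr (congrArg _ (congrArg _ (funext fun i => ?_))) (funext fun i => ?_))
    · rcases i with _ | i | i
      · rfl
      · simp only [queryNumbers, testBit_unzip, ext, Option.elim_some, Sum.elim_inl, mul_zero,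
          zero_add]
        split <;> simp [*]
      · simp only [queryNumbers, testBit_unzip, ext, Option.elim_some, Sum.elim_inr, mul_zero,
          zero_add]
        split
        · rw [dif_pos (by omega)]
        · simp
    · rcases i with _ | i | i
      · rfl
      · exact unzip_div_two _ _ _
      · exact unzip_div_two _ _ _
  · intro hd hd' q
    simp only [unzip_zero]
  · intro n p
    rw [hf, ← hP₀]

/-! ### Numbering of gates -/

/-- The number whose first `W` digits are `t` and whose other digits are those of the numbers
`e 0`, …, `e (W - 1)` with `L` digits each, interleaved. -/
def zip (W L : ℕ) (t : Fin W → Bool) (e : ℕ → ℕ) : ℕ :=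
  Nat.ofBits fun m : Fin (W * (L + 1)) =>
    if h : m < W then t ⟨m, h⟩ else (e (m % W)).testBit (m / W - 1)

section

variable {W L : ℕ} (t : Fin W → Bool) (e : ℕ → ℕ)

theorem zip_lt : zip W L t e < 2 ^ (W * (L + 1)) :=
  Nat.ofBits_lt_two_pow _

theorem testBit_zip (c : Fin W) : (zip W L t e).testBit c = t c := by
  have : (c : ℕ) < W * (L + 1) := c.2.trans_le (Nat.le_mul_of_pos_right _ L.succ_pos)
  rw [zip, Nat.testBit_ofBits_lt _ _ this]
  simp

theorem unzip_zip (he : ∀ c, e c < 2 ^ L) (he' : ∀ c, W ≤ c → e c = 0) :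
    unzip W (zip W L t e / 2 ^ W) = e := by
  refine funext fun c => Nat.eq_of_testBit_eq fun j => ?_
  rw [testBit_unzip]
  split
  · rename_i hc
    have h₁ : (W * j + c + W) % W = c := by
      rw [Nat.add_mod_right, Nat.mul_add_mod, Nat.mod_eq_of_lt hc]
    have h₂ : (W * j + c + W) / W - 1 = j := by
      rw [Nat.add_div_right _ (by omega), Nat.mul_add_div (by omega), Nat.div_eq_of_lt hc]
      rfl
    rw [Nat.testBit_div_two_pow]
    by_cases hj : j < L
    · have : W * j + c + W < W * (L + 1) := by nlinarith
      rw [zip, Nat.testBit_ofBits_lt _ _ this]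
      simp [h₁, h₂]
    · have : W * (L + 1) ≤ W * j + c + W := by nlinarith [not_lt.1 hj]
      rw [zip, Nat.testBit_ofBits_ge _ _ this, Nat.testBit_eq_false_of_lt]
      exact (he c).trans_le (Nat.pow_le_pow_right two_pos (not_lt.1 hj))
  · rename_i hc
    rw [he' c (not_lt.1 hc)]
    simp

/-- For `m ≥ W`, digit `m` of a gate number is digit `m / W - 1` of component `m % W`. -/
theorem gate_ext {g g' : ℕ} (h : ∀ c < W, g.testBit c = g'.testBit c) (hW : 0 < W)
    (h' : unzip W (g / 2 ^ W) = unzip W (g' / 2 ^ W)) : g = g' := by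
  refine Nat.eq_of_testBit_eq fun m => ?_
  by_cases hm : m < W
  · exact h m hm
  · have h₁ := congrArg (fun e => (e (m % W)).testBit (m / W - 1)) h'
    have h₂ : W * (m / W - 1) + m % W + W = m := by
      have h₃ := Nat.div_add_mod m W
      have h₄ : 1 ≤ m / W := (Nat.one_le_div_iff hW).2 (not_lt.1 hm)
      obtain ⟨k, hk⟩ := Nat.exists_eq_add_of_le h₄
      rw [hk] at h₃ ⊢
      rw [Nat.add_sub_cancel_left]
      linarith
    simpa only [testBit_unzip, Nat.mod_lt m hW, if_true, Nat.testBit_div_two_pow, h₂] using h₁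

/-- With `L = n.size` this turns "is a gate of the `n`-th circuit" into comparisons of lengths,
which are automatic by `Automatic.size_le`. -/
theorem lt_two_pow_iff (hW : 0 < W) (g : ℕ) :
    g < 2 ^ (W * (L + 1)) ↔ ∀ c : Fin W, (unzip W (g / 2 ^ W) c).size ≤ L := by
  constructor
  · intro h c
    refine Nat.size_le.2 (Nat.lt_pow_two_of_testBit _ fun j hj => ?_)
    rw [testBit_unzip, if_pos c.2, Nat.testBit_div_two_pow]
    refine Nat.testBit_eq_false_of_lt (h.trans_le (Nat.pow_le_pow_right two_pos ?_))
    nlinarith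
  · intro h
    refine Nat.lt_pow_two_of_testBit _ fun m hm => ?_
    have hm' : L + 1 ≤ m / W := (Nat.le_div_iff_mul_le hW).2 (by linarith)
    have h₁ := h ⟨m % W, Nat.mod_lt m hW⟩
    have h₂ : (unzip W (g / 2 ^ W) (m % W)).testBit (m / W - 1) = false :=
      Nat.testBit_eq_false_of_lt ((Nat.size_le.1 h₁).trans_le
        (Nat.pow_le_pow_right two_pos (by omega)))
    rw [testBit_unzip, if_pos (Nat.mod_lt m hW), Nat.testBit_div_two_pow] at h₂
    convert h₂ using 2
    have h₃ := Nat.div_add_mod m W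
    obtain ⟨k, hk⟩ := Nat.exists_eq_add_of_le hm'
    rw [hk] at h₃ ⊢
    rw [show L + 1 + k - 1 = L + k by omega]
    linarith

end

end Threshold

/-! ### Uniform systems of gates -/

namespace Threshold

variable {A : Type}

/-- Properties of a word and of an assignment of numbers to variables. -/
abbrev WordPred (A : Type) : Type :=
  ∀ n : ℕ, (Fin n → A) → (ℕ → ℕ) → Prop

/-- The kinds of nodes: tests of a letter of the input at the position given by a variable, tests of
a numerical relation between the variables, and gates that quantify over all values of the variables
in a finite set. -/
inductive Kind (A : Type) : Type
  | input (j : ℕ) (s : A)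
  | atom (R : (ℕ → ℕ) → Prop)
  | gate (o : Op) (S : Finset ℕ)

/-- Two assignments agree outside `S`, and the values of the second one on `S` are small. -/
def Agree (n : ℕ) (S : Finset ℕ) (e e' : ℕ → ℕ) : Prop :=
  (∀ i ∈ S, e' i < 2 ^ n.size) ∧ ∀ i ∉ S, e' i = e i

/-- A finite system of nodes, each of which stands for one gate for every assignment of small
numbers to the variables. -/
structure System (A : Type) where
  Node : Type
  [fintype : Fintype Node]
  kind : Node → Kind A
  children : Node → Finset Node
  rank : Node → ℕ
  rank_lt : ∀ t, ∀ t' ∈ children t, rank t' < rank t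
  automatic : ∀ t R, kind t = .atom R → Automatic R
  gate_not : ∀ t S, kind t = .gate .not S → S = ∅ ∧ (children t).card = 1
  -- The meaning is a field pinned down by the equations below, rather than a recursion along
  -- `rank`; systems can then be assembled from systems with known meanings.
  sem : Node → WordPred A
  sem_input : ∀ t j s, kind t = .input j s →
    ∀ n x e, sem t n x e ↔ ∃ h : e j < n, x ⟨e j, h⟩ = s
  sem_atom : ∀ t R, kind t = .atom R → ∀ n x e, sem t n x e ↔ R e
  sem_and : ∀ t S, kind t = .gate .and S →
    ∀ n x e, sem t n x e ↔ ∀ t' ∈ children t, ∀ e', Agree n S e e' → sem t' n x e'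
  sem_or : ∀ t S, kind t = .gate .or S →
    ∀ n x e, sem t n x e ↔ ∃ t' ∈ children t, ∃ e', Agree n S e e' ∧ sem t' n x e'
  sem_not : ∀ t S, kind t = .gate .not S →
    ∀ n x e, sem t n x e ↔ ∀ t' ∈ children t, ¬ sem t' n x e
  sem_maj : ∀ t S, kind t = .gate .maj S →
    ∀ n x e, sem t n x e ↔ ∑ _t' ∈ children t, {e' | Agree n S e e'}.ncard ≤
      2 * ∑ t' ∈ children t, {e' | Agree n S e e' ∧ sem t' n x e'}.ncard

attribute [instance] System.fintype

/-- The largest variable of a node. -/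
def Kind.bound : Kind A → ℕ
  | .input j _ => j
  | .atom _ => 0
  | .gate _ S => S.sup id

/-- The label of the gate of some kind for the assignment `e`. -/
noncomputable def Kind.label (k : Kind A) (n : ℕ) (e : ℕ → ℕ) : GateLabel A n :=
  open Classical in
  match k with
  -- Gates without children are constants: an empty disjunction is false, an empty conjunction is
  -- true. A test beyond the end of the word is false.
  | .input j s => if h : e j < n then .input ⟨e j, h⟩ s else .inner .or
  | .atom R => if R e then .inner .and else .inner .or
  | .gate o _ => .inner o

namespace System

variable (Y : System A) {W : ℕ} (code : Y.Node ↪ (Fin W → Bool))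

/-- The node of a gate. -/
noncomputable def node (g : ℕ) : Option Y.Node :=
  Function.partialInv code fun c => g.testBit c

theorem node_eq_some {g : ℕ} {t : Y.Node} :
    Y.node code g = some t ↔ code t = fun c : Fin W => g.testBit c :=
  Function.Injective.isPartialInv code.injective _ _

theorem node_zip (L : ℕ) (t : Y.Node) (e : ℕ → ℕ) : Y.node code (zip W L (code t) e) = some t := by
  rw [node_eq_some]
  funext c
  rw [testBit_zip]

/-- The gate `h` belongs to a child of the node `t`, and its assignment agrees outside `S` with that
of `g`. -/
def IsChild (t : Y.Node) (S : Finset ℕ) (g h : ℕ) : Prop :=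
  ∃ t' ∈ Y.children t, Y.node code h = some t' ∧
    ∀ c : Fin W, (c : ℕ) ∉ S → unzip W (h / 2 ^ W) c = unzip W (g / 2 ^ W) c

/-- The label of a gate. -/
noncomputable def label (n g : ℕ) : GateLabel A n :=
  match Y.node code g with
  -- Numbers that carry no code are idle gates: they have no children and are nobody's child.
  | none => .inner .and
  | some t => (Y.kind t).label n (unzip W (g / 2 ^ W))

/-- The relation between a gate and its children. -/
def ChildRel (g h : ℕ) : Prop :=
  ∃ t o S, Y.node code g = some t ∧ Y.kind t = .gate o S ∧ Y.IsChild code t S g h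

/-- The level of a gate. -/
noncomputable def level (g : ℕ) : ℕ :=
  ((Y.node code g).map Y.rank).getD 0

theorem level_lt {g h : ℕ} (H : Y.ChildRel code g h) : Y.level code h < Y.level code g := by
  obtain ⟨t, o, S, ht, -, t', ht', hh, -⟩ := H
  simp [level, ht, hh, Y.rank_lt t t' ht']

variable {code}

section

variable (hS : ∀ t, (Y.kind t).bound < W) (n : ℕ)

include hS in
theorem mem_lt {t : Y.Node} {o : Op} {S : Finset ℕ} (h : Y.kind t = .gate o S) {i : ℕ}
    (hi : i ∈ S) : i < W := by
  have := hS t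
  rw [h] at this
  exact (Finset.le_sup (f := id) hi).trans_lt this

include hS in
/-- The children of a gate correspond to the child nodes and the assignments. -/
theorem bijOn_children {t : Y.Node} {o : Op} {S : Finset ℕ} (h : Y.kind t = .gate o S)
    {t' : Y.Node} (ht' : t' ∈ Y.children t) {g : ℕ} (hg : g < 2 ^ (W * (n.size + 1))) :
    Set.BijOn (fun h => unzip W (h / 2 ^ W))
      {h | h < 2 ^ (W * (n.size + 1)) ∧ Y.node code h = some t' ∧ Y.IsChild code t S g h}
      {e' | Agree n S (unzip W (g / 2 ^ W)) e'} := by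
  have hW : 0 < W := (Nat.zero_le _).trans_lt (hS t)
  have hlt : ∀ g c, g < 2 ^ (W * (n.size + 1)) → unzip W (g / 2 ^ W) c < 2 ^ n.size := by
    intro g c hg
    by_cases hc : c < W
    · exact Nat.size_le.1 ((lt_two_pow_iff hW g).1 hg ⟨c, hc⟩)
    · simp [unzip, hc]
  refine ⟨?_, ?_, ?_⟩
  · rintro h ⟨hh, -, t'', -, -, hc⟩
    refine ⟨fun i _ => hlt _ _ hh, fun i hi => ?_⟩
    by_cases hiW : i < W
    · exact hc ⟨i, hiW⟩ hi
    · simp [unzip, hiW]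
  · rintro h ⟨-, hh, -⟩ h' ⟨-, hh', -⟩ heq
    rw [node_eq_some] at hh hh'
    exact gate_ext (fun c hc => congrFun (hh.symm.trans hh') ⟨c, hc⟩) hW heq
  · rintro e' ⟨he, he'⟩
    have h₁ : ∀ c, e' c < 2 ^ n.size := fun c => by
      by_cases hc : c ∈ S
      · exact he c hc
      · rw [he' c hc]
        exact hlt _ _ hg
    have h₂ : ∀ c, W ≤ c → e' c = 0 := fun c hc => by
      rw [he' c fun hcS => (Y.mem_lt hS h hcS).not_ge hc]
      simp [unzip, hc]
    have h₃ := unzip_zip (code t') e' h₁ h₂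
    exact ⟨zip W n.size (code t') e', ⟨zip_lt _ _, Y.node_zip code _ _ _, t', ht',
      Y.node_zip code _ _ _, fun c hc => by rw [h₃, he' c hc]⟩, h₃⟩

end

end System

end Threshold

/-! ### The circuit of a system and its value -/

namespace Threshold.System

variable {A : Type} (Y : System A) {W : ℕ} {code : Y.Node ↪ (Fin W → Bool)}
  (hS : ∀ t, (Y.kind t).bound < W) (n : ℕ)

-- Majority gates need the exact number of children. They are sorted by their nodes, and within one
-- node `bijOn_children` identifies them with assignments.
include hS in
open Classical in
theorem card_children {t : Y.Node} {o : Op} {S : Finset ℕ} (h : Y.kind t = .gate o S)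
    {g : ℕ} (hg : g < 2 ^ (W * (n.size + 1))) (hgt : Y.node code g = some t)
    (p : Fin (2 ^ (W * (n.size + 1))) → Prop) (p' : Y.Node → (ℕ → ℕ) → Prop)
    (hp : ∀ h : Fin (2 ^ (W * (n.size + 1))), ∀ t' ∈ Y.children t, Y.node code h = some t' →
      (p h ↔ p' t' (unzip W (h / 2 ^ W)))) :
    {h : Fin (2 ^ (W * (n.size + 1))) | Y.ChildRel code g h ∧ p h}.ncard =
      ∑ t' ∈ Y.children t, {e' | Agree n S (unzip W (g / 2 ^ W)) e' ∧ p' t' e'}.ncard := by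
  have hrel : ∀ h', Y.ChildRel code g h' ↔ Y.IsChild code t S g h' := by
    intro h'
    constructor
    · rintro ⟨t₁, o₁, S₁, h₁, h₂, h₃⟩
      obtain rfl : t = t₁ := Option.some_injective _ (hgt.symm.trans h₁)
      rw [h] at h₂
      cases h₂
      exact h₃
    · exact fun h' => ⟨t, o, S, hgt, h, h'⟩
  rw [Set.ncard_eq_toFinset_card', Set.toFinset_ofPred]
  refine (Finset.card_eq_sum_card_fiberwise
    (f := fun h : Fin (2 ^ (W * (n.size + 1))) => Y.node code h)
    (t := (Y.children t).map Function.Embedding.some) ?_).trans ?_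
  rotate_left
  · rw [Finset.sum_map]
    refine Finset.sum_congr rfl fun t' ht' => ?_
    have hb := Y.bijOn_children (code := code) hS n h ht' hg
    rw [← Set.ncard_coe_finset]
    refine Set.ncard_congr (fun h _ => unzip W (h / 2 ^ W)) ?_ ?_ ?_
    · intro h' hh'
      simp only [Finset.coe_filter, Finset.mem_filter, Finset.mem_univ, true_and,
        Function.Embedding.some_apply, Set.mem_ofPred_eq, hrel] at hh'
      exact ⟨hb.mapsTo ⟨h'.2, hh'.2, hh'.1.1⟩, (hp _ _ ht' hh'.2).1 hh'.1.2⟩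
    · intro h' h'' hh' hh'' heq
      simp only [Finset.coe_filter, Finset.mem_filter, Finset.mem_univ, true_and,
        Function.Embedding.some_apply, Set.mem_ofPred_eq, hrel] at hh' hh''
      exact Fin.ext (hb.injOn ⟨h'.2, hh'.2, hh'.1.1⟩ ⟨h''.2, hh''.2, hh''.1.1⟩ heq)
    · rintro e' ⟨he', hpe⟩
      obtain ⟨h', ⟨h₁, h₂, h₃⟩, rfl⟩ := hb.surjOn he'
      refine ⟨⟨h', h₁⟩, ?_, rfl⟩
      simp only [Finset.coe_filter, Finset.mem_filter, Finset.mem_univ, true_and,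
        Function.Embedding.some_apply, Set.mem_ofPred_eq, hrel]
      exact ⟨⟨h₃, (hp ⟨h', h₁⟩ _ ht' h₂).2 hpe⟩, h₂⟩
  · intro h' hh'
    simp only [Finset.coe_filter, Finset.mem_univ, true_and, Set.mem_ofPred_eq, hrel] at hh'
    obtain ⟨⟨t', ht', h₁, -⟩, -⟩ := hh'
    simp [ht', h₁]

theorem label_eq_not {g : ℕ} (h : Y.label code n g = .inner .not) :
    ∃ t S, Y.node code g = some t ∧ Y.kind t = .gate .not S := by
  unfold label at h
  split at h
  · cases h
  · rename_i t ht
    refine ⟨t, ?_⟩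
    unfold Kind.label at h
    split at h
    · split at h <;> cases h
    · split at h <;> cases h
    · rename_i o S hk
      cases h
      exact ⟨S, ht, hk⟩

theorem label_of_kind_gate {g : ℕ} {t : Y.Node} {o : Op} {S : Finset ℕ}
    (ht : Y.node code g = some t) (hk : Y.kind t = .gate o S) :
    Y.label code n g = .inner o := by
  simp [label, ht, hk, Kind.label]

theorem agree_empty (e : ℕ → ℕ) : {e' | Agree n ∅ e e'} = {e} := by
  ext e'
  simp [Agree, funext_iff]

open Classical in
include hS in
theorem card_children_not {g : ℕ} (hg : g < 2 ^ (W * (n.size + 1)))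
    (h : Y.label code n g = .inner .not) :
    (Finset.univ.filter fun h : Fin (2 ^ (W * (n.size + 1))) => Y.ChildRel code g h).card = 1 := by
  obtain ⟨t, S, ht, hk⟩ := Y.label_eq_not n h
  have hc := Y.card_children hS n hk hg ht (fun _ => True) (fun _ _ => True) (by simp)
  obtain ⟨rfl, h₁⟩ := Y.gate_not t S hk
  rw [← Set.ncard_coe_finset, Finset.coe_filter]
  simpa [agree_empty, h₁] using hc

theorem not_childRel_of_label_eq_input {g : ℕ} {i : Fin n} {s : A}
    (h : Y.label code n g = .input i s) (h' : ℕ) : ¬ Y.ChildRel code g h' := by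
  rintro ⟨t, o, S, ht, hk, -⟩
  rw [Y.label_of_kind_gate n ht hk] at h
  cases h

variable (code) in
open Classical in
/-- The circuit for words of length `n`. -/
noncomputable def circuit (root : Y.Node) : Circuit A n where
  size := 2 ^ (W * (n.size + 1))
  label g := Y.label code n g
  children g := Finset.univ.filter fun h => Y.ChildRel code g h
  acyclic := Subrelation.wf (r := InvImage (· < ·) fun g : Fin _ => Y.level code g)
    (fun h => Y.level_lt code (Finset.mem_filter.1 h).2) (InvImage.wf _ wellFounded_lt)
  children_input g i s h := by
    simpa [Finset.filter_eq_empty_iff] using fun h' => Y.not_childRel_of_label_eq_input n h _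
  card_children_not g h := Y.card_children_not hS n g.2 h
  output := ⟨zip W n.size (code root) 0, zip_lt _ _⟩

theorem mem_children_circuit (root : Y.Node) {g h : Fin (Y.circuit code hS n root).size} :
    h ∈ (Y.circuit code hS n root).children g ↔ Y.ChildRel code g h := by
  classical exact Finset.mem_filter.trans (and_iff_right (Finset.mem_univ _))

theorem value_circuit (root : Y.Node) (x : Fin n → A) (t : Y.Node)
    (g : Fin (Y.circuit code hS n root).size) (hg : Y.node code g = some t) :
    (Y.circuit code hS n root).value x g ↔ Y.sem t n x (unzip W (g / 2 ^ W)) := by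
  classical
  induction hr : Y.rank t using Nat.strong_induction_on generalizing t g with
  | _ r ih =>
  subst hr
  have ih' : ∀ t' ∈ Y.children t, ∀ h : Fin (Y.circuit code hS n root).size,
      Y.node code h = some t' →
      ((Y.circuit code hS n root).value x h ↔ Y.sem t' n x (unzip W (h / 2 ^ W))) :=
    fun t' ht' h hh => ih _ (Y.rank_lt t t' ht') t' h hh rfl
  have hlab : (Y.circuit code hS n root).label g = (Y.kind t).label n (unzip W (g / 2 ^ W)) := by
    change Y.label code n g = _
    simp [label, hg]
  rw [Circuit.value_eq, hlab]
  cases hk : Y.kind t with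
  | input j s =>
    have hno : ∀ h, ¬ Y.ChildRel code g h := by
      rintro h ⟨t', o, S, ht', hk', -⟩
      obtain rfl : t = t' := Option.some_injective _ (hg.symm.trans ht')
      rw [hk] at hk'
      cases hk'
    rw [Y.sem_input t j s hk]
    by_cases hj : unzip W (g / 2 ^ W) j < n
    · simp [Kind.label, hj]
    · simp [Kind.label, hj, mem_children_circuit, hno]
  | atom R =>
    have hno : ∀ h, ¬ Y.ChildRel code g h := by
      rintro h ⟨t', o, S, ht', hk', -⟩
      obtain rfl : t = t' := Option.some_injective _ (hg.symm.trans ht')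
      rw [hk] at hk'
      cases hk'
    rw [Y.sem_atom t R hk]
    by_cases hj : R (unzip W (g / 2 ^ W))
    · simp [Kind.label, hj, mem_children_circuit, hno]
    · simp [Kind.label, hj, mem_children_circuit, hno]
  | gate o S =>
    have hrel : ∀ h, Y.ChildRel code g h ↔ Y.IsChild code t S g h := by
      intro h'
      constructor
      · rintro ⟨t₁, o₁, S₁, h₁, h₂, h₃⟩
        obtain rfl : t = t₁ := Option.some_injective _ (hg.symm.trans h₁)
        rw [hk] at h₂
        cases h₂
        exact h₃
      · exact fun h' => ⟨t, o, S, hg, hk, h'⟩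
    have hforall : ∀ p : Y.Node → (ℕ → ℕ) → Prop,
        (∀ h : Fin (Y.circuit code hS n root).size, Y.ChildRel code g h → ∀ t' ∈ Y.children t,
          Y.node code h = some t' → p t' (unzip W (h / 2 ^ W))) ↔
        ∀ t' ∈ Y.children t, ∀ e', Agree n S (unzip W (g / 2 ^ W)) e' → p t' e' := by
      intro p
      constructor
      · intro H t' ht' e' he'
        obtain ⟨h, ⟨h₁, h₂, h₃⟩, rfl⟩ := (Y.bijOn_children hS n hk ht' g.2).surjOn he'
        exact H ⟨h, h₁⟩ ((hrel h).2 h₃) t' ht' h₂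
      · intro H h hh t' ht' hht'
        exact H t' ht' _
          ((Y.bijOn_children hS n hk ht' g.2).mapsTo ⟨h.2, hht', (hrel h).1 hh⟩)
    -- The parameter `q` lets one transfer serve three gates: the identity for conjunctions,
    -- negation for disjunctions and for `not`.
    have hval : ∀ q : Prop → Prop, (∀ h : Fin (Y.circuit code hS n root).size,
        Y.ChildRel code g h → q ((Y.circuit code hS n root).value x h)) ↔
        ∀ t' ∈ Y.children t, ∀ e', Agree n S (unzip W (g / 2 ^ W)) e' → q (Y.sem t' n x e') := by
      intro q
      rw [← hforall fun t' e' => q (Y.sem t' n x e')]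
      refine forall₂_congr fun h hh => ?_
      obtain ⟨t', ht', hht', -⟩ := (hrel h).1 hh
      constructor
      · intro H t'' ht'' hht''
        rwa [← ih' t'' ht'' h hht'']
      · intro H
        rw [ih' t' ht' h hht']
        exact H t' ht' hht'
    cases o with
    | and =>
      simp only [Kind.label, mem_children_circuit]
      rw [Y.sem_and t S hk]
      exact hval id
    | or =>
      simp only [Kind.label, mem_children_circuit]
      rw [Y.sem_or t S hk]
      have := not_congr (hval Not)
      push Not at this
      simpa only [exists_prop] using this
    | not =>
      simp only [Kind.label, mem_children_circuit]
      rw [Y.sem_not t S hk, hval Not]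
      obtain ⟨rfl, -⟩ := Y.gate_not t S hk
      have := agree_empty n (unzip W (g / 2 ^ W))
      simp only [Set.ext_iff, Set.mem_ofPred_eq, Set.mem_singleton_iff] at this
      simp only [this, forall_eq]
    | maj =>
      simp only [Kind.label, mem_children_circuit]
      rw [Y.sem_maj t S hk]
      have h₁ := Y.card_children hS n hk g.2 hg (fun _ => True) (fun _ _ => True) (by simp)
      have h₂ := Y.card_children hS n hk g.2 hg (fun h => (Y.circuit code hS n root).value x h)
        (fun t' e' => Y.sem t' n x e') (fun h t' ht' hh => ih' t' ht' h hh)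
      have h₃ : ((Y.circuit code hS n root).children g).card =
          {h : Fin (Y.circuit code hS n root).size | Y.ChildRel code g h ∧ True}.ncard := by
        rw [← Set.ncard_coe_finset]
        congr 1
        ext h
        simp [mem_children_circuit]
      rw [h₃]
      exact iff_of_eq (congrArg₂ (fun a b => a ≤ 2 * b) (h₁.trans (by simp)) h₂)

end Threshold.System

theorem Automatic.or {ι : Type} {R R' : (ι → ℕ) → Prop} (h : Automatic R) (h' : Automatic R') :
    Automatic fun v => R v ∨ R' v := by
  simpa only [not_and_or, not_not] using (h.not.and h'.not).not

/-! ### The direct connection language of the circuits -/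

namespace Threshold.System

variable {A : Type} (Y : System A) {W : ℕ} (code : Y.Node ↪ (Fin W → Bool)) (root : Y.Node)

/-- The answer to a question of some kind about two gates whose first digits are `b` and `b'`, in
terms of the numbers in the question. -/
def Answer (hd : QuerySymbol A) (b b' : Fin W → Bool) (X : Option (ℕ ⊕ ℕ) → ℕ) : Prop :=
  match hd with
  | .input s => (∀ c : Fin W, (X (some (.inl c))).size ≤ (X none).size) ∧
      match (Function.partialInv code b).map Y.kind with
      | some (.input j s') => s' = s ∧ X (some (.inl j)) < X none ∧
          X (some (.inl j)) = X (some (.inr 0))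
      | _ => False
  | .inner o => (∀ c : Fin W, (X (some (.inl c))).size ≤ (X none).size) ∧
      match (Function.partialInv code b).map Y.kind with
      | none => o = .and
      | some (.input j _) => o = .or ∧ ¬ X (some (.inl j)) < X none
      | some (.atom R) => (o = .and ∧ R fun i => X (some (.inl i))) ∨
          (o = .or ∧ ¬ R fun i => X (some (.inl i)))
      | some (.gate o' _) => o' = o
  | .child => (∀ c : Fin W, (X (some (.inl c))).size ≤ (X none).size) ∧
      (∀ c : Fin W, (X (some (.inr c))).size ≤ (X none).size) ∧
      match Function.partialInv code b, Function.partialInv code b' with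
      | some t, some t' =>
        match Y.kind t with
        | .gate _ S => t' ∈ Y.children t ∧
          ∀ c : Fin W, (c : ℕ) ∉ S → X (some (.inr c)) = X (some (.inl c))
        | _ => False
      | _, _ => False
  | .output => b = code root ∧ ∀ c : Fin W, X (some (.inl c)) = 0
  | _ => False

/-- For fixed codes the nodes are known and all case distinctions are constants. What remains are
comparisons of components and the atoms, which are automatic by assumption on the system. -/
theorem automatic_answer (hd : QuerySymbol A) (b b' : Fin W → Bool) :
    Automatic (Y.Answer code root hd b b') := by
  unfold Answer
  have hsize := Automatic.forall_finite fun c : Fin W =>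
    Automatic.size_le (some (.inl c) : Option (ℕ ⊕ ℕ)) none
  cases hd with
  | input s =>
    refine hsize.and ?_
    cases (Function.partialInv code b).map Y.kind with
    | none => exact .const _
    | some k =>
      cases k with
      | input j s' => exact (Automatic.const _).and ((Automatic.lt _ _).and (Automatic.eq _ _))
      | _ => exact .const _
  | inner o =>
    refine hsize.and ?_
    cases hk : (Function.partialInv code b).map Y.kind with
    | none => exact .const _
    | some k =>
      cases k with
      | input j s' => exact (Automatic.const _).and (Automatic.lt _ _).not
      | gate o S => exact .const _
      | atom R =>
        obtain ⟨t, -, ht⟩ := Option.map_eq_some_iff.1 hk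
        have := (Y.automatic t R ht).comap fun i => some (some (.inl i : ℕ ⊕ ℕ))
        exact ((Automatic.const _).and this).or ((Automatic.const _).and this.not)
  | child =>
    refine hsize.and ((Automatic.forall_finite fun c => Automatic.size_le _ _).and ?_)
    cases Function.partialInv code b with
    | none => exact .const _
    | some t =>
      cases Function.partialInv code b' with
      | none => exact .const _
      | some t' =>
        dsimp only
        cases Y.kind t with
        | gate o S =>
          refine (Automatic.const _).and (Automatic.forall_finite fun c => ?_)
          by_cases hc : (c : ℕ) ∈ S
          · simpa [hc] using Automatic.const True
          · simpa [hc] using Automatic.eq _ _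
        | _ => exact .const _
  | output => exact (Automatic.const _).and (Automatic.forall_finite fun c => Automatic.eq_zero _)
  | _ => exact .const _

variable {code} (hS : ∀ t, (Y.kind t).bound < W)

include hS in
theorem holds_iff (n : ℕ) (p : Query A) : p.Holds (Y.circuit code hS n root) ↔
    Y.Answer code root p.symbol (fun c => p.gate.testBit c) (p.argTag W)
      (queryNumbers n (unzip W (p.gate / 2 ^ W)) (unzip (p.symbol.width W) (p.argRest W))) := by
  have hW : 0 < W := (Nat.zero_le _).trans_lt (hS root)
  have hlt : ∀ g, (∀ c : Fin W, (unzip W (g / 2 ^ W) c).size ≤ n.size) ↔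
      g < (Y.circuit code hS n root).size := fun g => (lt_two_pow_iff hW g).symm
  have hnode : ∀ g, Function.partialInv code (fun c => g.testBit c) = Y.node code g := fun _ => rfl
  cases p with
  | input g i s =>
    have hi : unzip 1 i 0 = i := by simp [unzip, digitsAt_one]
    simp only [Query.Holds, Answer, Query.symbol, Query.gate, Query.argRest, Query.arg,
      queryNumbers,
      Option.elim_some, Option.elim_none, Sum.elim_inl, Sum.elim_inr, QuerySymbol.width, hlt, hi,
      hnode]
    rw [← exists_prop]
    refine exists_congr fun hg => ?_
    change (∃ hi : i < n, Y.label code n g = _) ↔ _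
    unfold label
    cases Y.node code g with
    | none => simp
    | some t =>
      simp only [Option.map_some]
      cases Y.kind t with
      | input j s' =>
        simp only [Kind.label]
        by_cases hj : unzip W (g / 2 ^ W) j < n
        · simp only [hj, dite_true, GateLabel.input.injEq, Fin.mk.injEq, true_and]
          constructor
          · rintro ⟨_, h, h'⟩
            exact ⟨h', h⟩
          · rintro ⟨h, h'⟩
            exact ⟨h' ▸ hj, h', h⟩
        · simp [hj]
      | atom R =>
        simp only [Kind.label]
        split <;> simp
      | gate o S => simp [Kind.label]
  | inner g o =>
    simp only [Query.Holds, Answer, Query.symbol, Query.gate, queryNumbers,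
      Option.elim_some, Option.elim_none, Sum.elim_inl, hlt, hnode]
    rw [← exists_prop]
    refine exists_congr fun hg => ?_
    change Y.label code n g = _ ↔ _
    unfold label
    cases Y.node code g with
    | none => simp [eq_comm]
    | some t =>
      simp only [Option.map_some]
      cases Y.kind t with
      | input j s' =>
        simp only [Kind.label]
        by_cases hj : unzip W (g / 2 ^ W) j < n <;> simp [hj, eq_comm]
      | atom R =>
        simp only [Kind.label]
        split <;> simp [*, eq_comm]
      | gate o S => simp [Kind.label]
  | child g h =>
    simp only [Query.Holds, Answer, Query.symbol, Query.gate, queryNumbers, Query.argTag,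
      Query.argRest, QuerySymbol.width, Option.elim_some, Option.elim_none, Sum.elim_inl,
      Sum.elim_inr, hlt, hnode]
    rw [← exists_prop]
    refine exists_congr fun hg => ?_
    rw [← exists_prop]
    refine exists_congr fun hh => ?_
    rw [mem_children_circuit]
    constructor
    · rintro ⟨t, o, S, h₁, h₂, t', h₃, h₄, h₅⟩
      simp only [h₁, h₂, h₄]
      exact ⟨h₃, h₅⟩
    · intro H
      split at H
      · rename_i t t' ht ht'
        split at H
        · rename_i o S hk
          exact ⟨t, o, S, ht, hk, t', H.1, ht', H.2⟩
        · exact H.elim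
      · exact H.elim
  | output g =>
    simp only [Query.Holds, Answer, Query.symbol, Query.gate, queryNumbers, Option.elim_some,
      Sum.elim_inl]
    change zip W n.size (code root) 0 = g ↔ _
    have hz : unzip W (zip W n.size (code root) 0 / 2 ^ W) = 0 :=
      unzip_zip _ _ (by simp) (by simp)
    constructor
    · rintro rfl
      simp [hz, testBit_zip]
    · rintro ⟨h₁, h₂⟩
      refine gate_ext (fun c hc => ?_) hW ?_
      · rw [testBit_zip (code root) 0 ⟨c, hc⟩, ← h₁]
      · rw [hz]
        funext c
        by_cases hc : c < W
        · exact (h₂ ⟨c, hc⟩).symm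
        · simp [unzip, hc]

/-- A language described by a node of a system belongs to `TC⁰`. -/
theorem inTC0 [Finite A] (L : Language A)
    (hL : ∀ x : List A, x ∈ L ↔ Y.sem root x.length x.get 0) : InTC0 L := by
  classical
  -- Large enough to exceed every variable index and to give each node its own code of `W` digits.
  let W := 1 + Finset.univ.sup (fun t => (Y.kind t).bound) + Fintype.card Y.Node
  have hS : ∀ t, (Y.kind t).bound < W := fun t => by
    have := Finset.le_sup (f := fun t => (Y.kind t).bound) (Finset.mem_univ t)
    omega
  have hW : 0 < W := (Nat.zero_le _).trans_lt (hS root)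
  obtain ⟨code⟩ : Nonempty (Y.Node ↪ (Fin W → Bool)) :=
    Function.Embedding.nonempty_of_card_le (by
      rw [Fintype.card_fun, Fintype.card_bool, Fintype.card_fin]
      exact Nat.lt_two_pow_self.le.trans (Nat.pow_le_pow_right two_pos (by omega)))
  -- For `n ≥ 2` the size is at most `(4 * n) ^ W ≤ n ^ (3 * W)`; the summand `4 ^ W` covers `n <
  -- 2`. The depth is bounded by the largest rank, independently of `n`.
  refine ⟨fun n => Y.circuit code hS n root, ⟨4 ^ W + 3 * W, fun n => ?_⟩,
    ⟨Finset.univ.sup Y.rank, fun n => ⟨fun g => Y.level code g, ?_, ?_⟩⟩, ?_, fun x => ?_⟩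
  · change 2 ^ (W * (n.size + 1)) ≤ _
    rcases Nat.lt_or_ge n 2 with hn | hn
    · have : n.size ≤ 1 := Nat.size_le.2 (by simpa using hn)
      have h₁ : 2 ^ (W * (n.size + 1)) ≤ 2 ^ (2 * W) :=
        Nat.pow_le_pow_right two_pos (by nlinarith)
      rw [pow_mul 2 2 W, show 2 ^ 2 = 4 from rfl] at h₁
      exact h₁.trans ((Nat.le_add_right _ _).trans (Nat.le_add_left _ _))
    · have h₁ : 2 ^ n.size ≤ 2 * n := by
        have h₂ : ¬ n.size ≤ n.size - 1 := by
          have := Nat.size_pos.2 (by omega : 0 < n)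
          omega
        rw [Nat.size_le, not_lt] at h₂
        have h₃ : n.size = n.size - 1 + 1 := by
          have := Nat.size_pos.2 (by omega : 0 < n)
          omega
        rw [h₃, pow_succ]
        omega
      calc 2 ^ (W * (n.size + 1)) = (2 ^ n.size * 2) ^ W := by
            rw [← pow_succ, ← pow_mul, mul_comm]
        _ ≤ (n ^ 3) ^ W := Nat.pow_le_pow_left (by nlinarith [Nat.mul_le_mul hn hn]) _
        _ = n ^ (3 * W) := by rw [pow_mul]
        _ ≤ n ^ (4 ^ W + 3 * W) := Nat.pow_le_pow_right (by omega) (Nat.le_add_left _ _)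
        _ ≤ _ := Nat.le_add_right _ _
  · exact fun g h hh => Y.level_lt code ((Y.mem_children_circuit hS n root).1 hh)
  · intro g
    change ((Y.node code g).map Y.rank).getD 0 ≤ _
    generalize Y.node code g = o
    cases o with
    | none => exact Nat.zero_le _
    | some t => exact Finset.le_sup (f := Y.rank) (Finset.mem_univ t)
  · refine exists_linear_time_of_automatic hW (Y.Answer code root) (Y.automatic_answer code root) _
      fun n p => ?_
    rw [directConnection, decide_eq_true_iff, Y.holds_iff root hS]
  · rw [hL, Circuit.Accepts, Y.value_circuit hS _ root x.get root _ (Y.node_zip code _ _ _)]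
    change _ ↔ Y.sem root _ _ (unzip W (zip W _ (code root) 0 / 2 ^ W))
    rw [unzip_zip _ _ (by simp) (by simp)]

end Threshold.System

/-! ### Definable properties of words -/

namespace Threshold

variable {A : Type}

/-- The meaning of a gate that quantifies over the variables in `S`. -/
def gateSem {ι : Type} [Fintype ι] (o : Op) (S : Finset ℕ) (P : ι → WordPred A) : WordPred A :=
  fun n x e =>
    match o with
    | .and => ∀ i, ∀ e', Agree n S e e' → P i n x e'
    | .or => ∃ i, ∃ e', Agree n S e e' ∧ P i n x e'
    | .not => ∀ i, ¬ P i n x e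
    | .maj => ∑ _i : ι, {e' | Agree n S e e'}.ncard ≤
        2 * ∑ i, {e' | Agree n S e e' ∧ P i n x e'}.ncard

/-- The system with a single node that tests a letter of the input. -/
def System.input (j : ℕ) (s : A) : System A where
  Node := Unit
  kind _ := .input j s
  children _ := ∅
  rank _ := 0
  rank_lt := by simp
  automatic := by simp
  gate_not := by simp
  sem _ n x e := ∃ h : e j < n, x ⟨e j, h⟩ = s
  sem_input := by
    rintro _ _ _ h n x e
    cases h
    rfl
  sem_atom := by simp
  sem_and := by simp
  sem_or := by simp
  sem_not := by simp
  sem_maj := by simp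

/-- The system with a single node that tests a numerical relation. -/
def System.atom (A : Type) (R : (ℕ → ℕ) → Prop) (hR : Automatic R) : System A where
  Node := Unit
  kind _ := .atom R
  children _ := ∅
  rank _ := 0
  rank_lt := by simp
  automatic := by
    rintro _ _ h
    cases h
    exact hR
  gate_not := by simp
  sem _ n x e := R e
  sem_input := by simp
  sem_atom := by
    rintro _ _ h n x e
    cases h
    rfl
  sem_and := by simp
  sem_or := by simp
  sem_not := by simp
  sem_maj := by simp

/-- The disjoint union of systems together with a new gate above the given nodes. -/
def System.gate {ι : Type} [Fintype ι] (o : Op) (S : Finset ℕ)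
    (hnot : o = .not → S = ∅ ∧ Fintype.card ι = 1) (Y : ι → System A) (root : ∀ i, (Y i).Node) :
    System A where
  Node := Option (Σ i, (Y i).Node)
  kind t := t.elim (.gate o S) fun t => (Y t.1).kind t.2
  children t := t.elim (Finset.univ.map ⟨fun i => some ⟨i, root i⟩, fun i j h => by simp_all⟩)
    fun t => ((Y t.1).children t.2).map
      ⟨fun t' => some ⟨t.1, t'⟩, fun t₁ t₂ h => by simp_all⟩
  rank t := t.elim ((Finset.univ.sup fun i => (Y i).rank (root i)) + 1) fun t => (Y t.1).rank t.2
  rank_lt := by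
    rintro (_ | ⟨i, t⟩) t' ht'
    · simp only [Option.elim_none, Finset.mem_map, Finset.mem_univ, true_and] at ht'
      obtain ⟨i, rfl⟩ := ht'
      exact Nat.lt_succ_of_le (Finset.le_sup (f := fun i => (Y i).rank (root i))
        (Finset.mem_univ i))
    · simp only [Option.elim_some, Finset.mem_map] at ht'
      obtain ⟨t', ht', rfl⟩ := ht'
      exact (Y i).rank_lt t t' ht'
  automatic := by
    rintro (_ | ⟨i, t⟩) R h
    · cases h
    · exact (Y i).automatic t R h
  gate_not := by
    rintro (_ | ⟨i, t⟩) S' h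
    · cases h
      simpa using hnot rfl
    · simpa using (Y i).gate_not t S' h
  sem t := t.elim (gateSem o S fun i => (Y i).sem (root i)) fun t => (Y t.1).sem t.2
  sem_input := by
    rintro (_ | ⟨i, t⟩) j s h
    · cases h
    · exact (Y i).sem_input t j s h
  sem_atom := by
    rintro (_ | ⟨i, t⟩) R h
    · cases h
    · exact (Y i).sem_atom t R h
  sem_and := by
    rintro (_ | ⟨i, t⟩) S' h n x e
    · cases h
      simp [gateSem]
      rfl
    · simp
      exact (Y i).sem_and t S' h n x e
  sem_or := by
    rintro (_ | ⟨i, t⟩) S' h n x e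
    · cases h
      simp [gateSem]
      rfl
    · simp
      exact (Y i).sem_or t S' h n x e
  sem_not := by
    rintro (_ | ⟨i, t⟩) S' h n x e
    · cases h
      simp [gateSem]
      rfl
    · simp
      exact (Y i).sem_not t S' h n x e
  sem_maj := by
    rintro (_ | ⟨i, t⟩) S' h n x e
    · cases h
      simp [gateSem]
      rfl
    · simp only [Option.elim_some, Finset.sum_map]
      exact (Y i).sem_maj t S' h n x e

/-- A property of words and assignments is definable if it is described by a node of a system. -/
def Definable (P : WordPred A) : Prop :=
  ∃ (Y : System A) (t : Y.Node), Y.sem t = P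

namespace Definable

variable {P P' : WordPred A}

theorem inTC0 [Finite A] (h : Definable P) (L : Language A)
    (hL : ∀ x : List A, x ∈ L ↔ P x.length x.get 0) : InTC0 L := by
  obtain ⟨Y, t, rfl⟩ := h
  exact Y.inTC0 t L hL

theorem input (j : ℕ) (s : A) :
    Definable fun n (x : Fin n → A) e => ∃ h : e j < n, x ⟨e j, h⟩ = s :=
  ⟨System.input j s, (), rfl⟩

theorem atom {R : (ℕ → ℕ) → Prop} (hR : Automatic R) : Definable fun n (_ : Fin n → A) e => R e :=
  ⟨System.atom A R hR, (), rfl⟩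

theorem gate {ι : Type} [Fintype ι] (o : Op) (S : Finset ℕ)
    (hnot : o = .not → S = ∅ ∧ Fintype.card ι = 1) {P : ι → WordPred A}
    (h : ∀ i, Definable (P i)) : Definable (gateSem o S P) := by
  choose Y t hY using h
  refine ⟨System.gate o S hnot Y t, none, ?_⟩
  rw [← funext hY]
  rfl

theorem not (h : Definable P) : Definable fun n x e => ¬ P n x e := by
  convert gate (ι := Unit) .not ∅ (by simp) fun _ => h using 4 with n x e
  simp [gateSem]

theorem forall_finite {ι : Type} [Finite ι] {P : ι → WordPred A} (h : ∀ i, Definable (P i)) :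
    Definable fun n x e => ∀ i, P i n x e := by
  have := Fintype.ofFinite ι
  convert gate .and ∅ (by simp) h using 4 with n x e
  simp [gateSem, Agree, ← funext_iff]

theorem and (h : Definable P) (h' : Definable P') : Definable fun n x e => P n x e ∧ P' n x e := by
  have : Definable fun n x e => ∀ b : Bool, (bif b then P else P') n x e :=
    forall_finite fun b => by cases b <;> assumption
  simpa [and_comm] using this

theorem or (h : Definable P) (h' : Definable P') : Definable fun n x e => P n x e ∨ P' n x e := by
  simpa only [not_and_or, not_not] using (h.not.and h'.not).not

theorem imp (h : Definable P) (h' : Definable P') :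
    Definable fun n x e => P n x e → P' n x e := by
  simpa only [imp_iff_not_or] using h.not.or h'

theorem exists_finite {ι : Type} [Finite ι] {P : ι → WordPred A} (h : ∀ i, Definable (P i)) :
    Definable fun n x e => ∃ i, P i n x e := by
  simpa only [not_forall, not_not] using (forall_finite fun i => (h i).not).not

theorem exists_agree (S : Finset ℕ) (h : Definable P) :
    Definable fun n x e => ∃ e', Agree n S e e' ∧ P n x e' := by
  convert gate (ι := Unit) .or S (by simp) fun _ => h using 4 with n x e
  simp [gateSem]

theorem agree_singleton {n i : ℕ} {e e' : ℕ → ℕ} :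
    Agree n {i} e e' ↔ ∃ y < 2 ^ n.size, e' = Function.update e i y := by
  constructor
  · rintro ⟨h₁, h₂⟩
    refine ⟨e' i, h₁ i (by simp), funext fun j => ?_⟩
    by_cases hj : j = i
    · simp [hj]
    · simp [hj, h₂]
  · rintro ⟨y, hy, rfl⟩
    refine ⟨by simpa using hy, fun j hj => ?_⟩
    simp_all

/-- Existential quantification over the variable `i`. -/
theorem ex (i : ℕ) (h : Definable P) :
    Definable fun n x e => ∃ y < 2 ^ n.size, P n x (Function.update e i y) := by
  convert exists_agree {i} h using 4 with n x e
  simp only [agree_singleton]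
  constructor
  · rintro ⟨y, hy, h⟩
    exact ⟨_, ⟨y, hy, rfl⟩, h⟩
  · rintro ⟨_, ⟨y, hy, rfl⟩, h⟩
    exact ⟨y, hy, h⟩

/-- Universal quantification over the variable `i`. -/
theorem all (i : ℕ) (h : Definable P) :
    Definable fun n x e => ∀ y < 2 ^ n.size, P n x (Function.update e i y) := by
  simpa only [not_exists, not_and, not_not] using (ex i h.not).not

theorem finite_agree (n : ℕ) (S : Finset ℕ) (e : ℕ → ℕ) : {e' | Agree n S e e'}.Finite := by
  classical
  refine (Finset.finite_toSet ((Fintype.piFinset fun _ : S => Finset.range (2 ^ n.size)).image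
    fun v i => if h : i ∈ S then v ⟨i, h⟩ else e i)).subset ?_
  rintro e' ⟨h₁, h₂⟩
  simp only [Finset.coe_image, Set.mem_image, Finset.mem_coe, Fintype.mem_piFinset,
    Finset.mem_range]
  refine ⟨fun i => e' i, fun i => h₁ i i.2, funext fun i => ?_⟩
  by_cases hi : i ∈ S
  · simp [hi]
  · simp [hi, h₂]

/-- Comparison of the numbers of values of the variables in `S` with two properties. -/
theorem ncard_agree_le (S : Finset ℕ) (h : Definable P) (h' : Definable P') :
    Definable fun n x e => {e' | Agree n S e e' ∧ P n x e'}.ncard ≤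
      {e' | Agree n S e e' ∧ P' n x e'}.ncard := by
  -- A majority over the instances of `¬ P` and of `P'`: of `2 * N` children, `(N - #P) + #P'` are
  -- true, which is at least half of them iff `#P ≤ #P'`.
  convert gate .maj S (by simp) (P := fun b : Bool => bif b then fun n x e => ¬ P n x e else P')
    (fun b => by cases b <;> [exact h'; exact h.not]) using 4 with n x e
  have hfin := finite_agree n S e
  have : Finite {e' | Agree n S e e' ∧ P n x e'} := hfin.subset fun _ h => h.1
  have : Finite {e' | Agree n S e e' ∧ ¬ P n x e'} := hfin.subset fun _ h => h.1
  have : {e' | Agree n S e e' ∧ P n x e'}.ncard + {e' | Agree n S e e' ∧ ¬ P n x e'}.ncard =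
      {e' | Agree n S e e'}.ncard := by
    rw [← Set.ncard_union_eq]
    · congr 1
      ext e'
      simp only [Set.mem_union, Set.mem_ofPred_eq]
      tauto
    · rw [Set.disjoint_left]
      rintro e' ⟨_, h₁⟩ ⟨_, h₂⟩
      exact h₂ h₁
  simp only [gateSem, Fintype.univ_bool, Finset.sum_const, smul_eq_mul, Finset.mem_singleton,
    Bool.true_eq_false, not_false_eq_true, Finset.sum_insert, cond_true, Finset.sum_singleton,
    cond_false]
  rw [Finset.card_pair (by simp)]
  omega

/-- Comparison of the numbers of values of the variable `i` with two properties. -/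
theorem ncard_le (i : ℕ) (h : Definable P) (h' : Definable P') :
    Definable fun n x e =>
      {y | y < 2 ^ n.size ∧ P n x (Function.update e i y)}.ncard ≤
      {y | y < 2 ^ n.size ∧ P' n x (Function.update e i y)}.ncard := by
  have key : ∀ (P : WordPred A) n x e,
      {y | y < 2 ^ n.size ∧ P n x (Function.update e i y)}.ncard =
        {e' | Agree n {i} e e' ∧ P n x e'}.ncard := by
    intro P n x e
    refine Set.ncard_congr (fun y _ => Function.update e i y) ?_ ?_ ?_
    · exact fun y hy => ⟨agree_singleton.2 ⟨y, hy.1, rfl⟩, hy.2⟩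
    · intro y y' _ _ hyy
      exact Function.update_injective _ _ hyy
    · rintro e' ⟨he, hP⟩
      obtain ⟨y, hy, rfl⟩ := agree_singleton.1 he
      exact ⟨y, ⟨hy, hP⟩, rfl⟩
  simp only [key]
  exact ncard_agree_le {i} h h'

theorem agree_pair {n i j : ℕ} (hij : i ≠ j) {e e' : ℕ → ℕ} :
    Agree n {i, j} e e' ↔ ∃ y < 2 ^ n.size, ∃ z < 2 ^ n.size,
      e' = Function.update (Function.update e i y) j z := by
  constructor
  · rintro ⟨h₁, h₂⟩
    refine ⟨e' i, h₁ i (by simp), e' j, h₁ j (by simp), funext fun k => ?_⟩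
    by_cases hj : k = j
    · simp [hj]
    · by_cases hi : k = i
      · subst hi
        simp [hj]
      · simp [hj, hi, h₂]
  · rintro ⟨y, hy, z, hz, rfl⟩
    refine ⟨by simpa [hij] using ⟨hy, hz⟩, fun k hk => ?_⟩
    simp_all

/-- Comparison of the numbers of values of the variables `i` and `j` with two properties. -/
theorem ncard_pairs_le {i j : ℕ} (hij : i ≠ j) (h : Definable P) (h' : Definable P') :
    Definable fun n x e =>
      {y : ℕ × ℕ | y.1 < 2 ^ n.size ∧ y.2 < 2 ^ n.size ∧
        P n x (Function.update (Function.update e i y.1) j y.2)}.ncard ≤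
      {y : ℕ × ℕ | y.1 < 2 ^ n.size ∧ y.2 < 2 ^ n.size ∧
        P' n x (Function.update (Function.update e i y.1) j y.2)}.ncard := by
  have key : ∀ (P : WordPred A) n x e,
      {y : ℕ × ℕ | y.1 < 2 ^ n.size ∧ y.2 < 2 ^ n.size ∧
        P n x (Function.update (Function.update e i y.1) j y.2)}.ncard =
        {e' | Agree n {i, j} e e' ∧ P n x e'}.ncard := by
    intro P n x e
    refine Set.ncard_congr (fun y _ => Function.update (Function.update e i y.1) j y.2) ?_ ?_ ?_
    · exact fun y hy => ⟨(agree_pair hij).2 ⟨_, hy.1, _, hy.2.1, rfl⟩, hy.2.2⟩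
    · intro y y' _ _ hyy
      have h₁ := congrFun hyy i
      have h₂ := congrFun hyy j
      simp [hij] at h₁ h₂
      exact Prod.ext h₁ h₂
    · rintro e' ⟨he, hP⟩
      obtain ⟨y, hy, z, hz, rfl⟩ := (agree_pair hij).1 he
      exact ⟨(y, z), ⟨hy, hz, hP⟩, rfl⟩
  simp only [key]
  exact ncard_agree_le {i, j} h h'

end Definable

end Threshold

/-! ### Products of periodic sequences -/

theorem Function.Periodic.eq_of_modEq_nat {G : Type*} {f : ℕ → G} {q : ℕ} (h : f.Periodic q)
    (k : ℕ) : f k = f (k % q) :=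
  (h.map_mod_nat k).symm

/-- A product of periodic sequences that vanishes on an initial segment whose length is the sum of
the periods vanishes everywhere. -/
theorem prod_eq_one_of_periodic {G ι : Type*} [CommGroup G] (s : Finset ι) (f : ι → ℕ → G)
    (q : ι → ℕ) (hq : ∀ i ∈ s, 1 ≤ q i ∧ (f i).Periodic (q i))
    (h : ∀ m < ∑ i ∈ s, q i, (∏ i ∈ s, f i) m = 1) : ∏ i ∈ s, f i = 1 := by
  classical
  induction s using Finset.induction_on generalizing f with
  | empty => simp
  | insert j s hj ih =>
    obtain ⟨hj₁, hj₂⟩ := hq j (Finset.mem_insert_self _ _)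
    rw [Finset.sum_insert hj] at h
    -- The shift by `q j` cancels `f j` and keeps the periods of the other factors, so the induction
    -- hypothesis applies to the quotients.
    have hshift : ∀ k, (∏ i ∈ insert j s, f i) (k + q j) / (∏ i ∈ insert j s, f i) k =
        (∏ i ∈ s, fun k => f i (k + q j) / f i k) k := by
      intro k
      simp only [Finset.prod_apply, Finset.prod_insert hj, hj₂ k, Finset.prod_div_distrib]
      rw [mul_div_mul_left_eq_div]
    have hone := ih (fun i k => f i (k + q j) / f i k)
      (fun i hi => ⟨(hq i (Finset.mem_insert_of_mem hi)).1, fun k => by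
        have := (hq i (Finset.mem_insert_of_mem hi)).2
        simp only [this k, show k + q i + q j = k + q j + q i by omega, this (k + q j)]⟩)
      (fun m hm => by
        rw [← hshift, h _ (by omega), h _ (by omega), div_one])
    have hper : (∏ i ∈ insert j s, f i).Periodic (q j) := fun k => by
      have := hshift k
      rw [hone, Pi.one_apply, div_eq_one] at this
      exact this
    funext k
    rw [hper.eq_of_modEq_nat k]
    exact h _ ((Nat.mod_lt _ hj₁).trans_le (Nat.le_add_right _ _))

/-! ### The formula for the membership problem -/

namespace Threshold

variable {A : Type}

/-- The letter at position `p` is `s`. -/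
def At (n : ℕ) (x : Fin n → A) (p : ℕ) (s : A) : Prop :=
  ∃ h : p < n, x ⟨p, h⟩ = s

/-- `z` is the largest power of two that is at most `y`. -/
def IsTop (z y : ℕ) : Prop :=
  y ≠ 0 ∧ z = 2 ^ Nat.log 2 y

section Formulas

variable {r : ℕ} (n : ℕ) (x : Fin n → InputSymbol (Fin r))

/-- No tuple ends strictly between the positions `y` and `p`. -/
def SameTuple (y p : ℕ) : Prop :=
  ∀ z < 2 ^ n.size, At n x z .endTuple → ¬ (y < z ∧ z < p) ∧ ¬ (p < z ∧ z < y)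

/-- The position `p` belongs to the entry of its tuple that gives the value for `k`. -/
def Contributes (p k : ℕ) : Prop :=
  ∃ t < 2 ^ n.size,
    {y : ℕ × ℕ | y.1 < 2 ^ n.size ∧ y.2 < 2 ^ n.size ∧ At n x y.2 .endEntry ∧
      SameTuple n x y.2 p ∧ (y.1 < t ∨ y.1 = t ∧ y.2 < p)}.ncard =
    {y : ℕ × ℕ | y.1 < 2 ^ n.size ∧ y.2 < 2 ^ n.size ∧ y.1 = t ∧ y.2 < k}.ncard

/-- The generator `s` occurs `v` times in the value for `k`. -/
def IsCount (s : Fin r) (k v : ℕ) : Prop :=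
  {p | p < 2 ^ n.size ∧ At n x p (.letter s) ∧ Contributes n x p k}.ncard =
  {p | p < 2 ^ n.size ∧ p < v}.ncard

/-- The value for `k` is trivial. -/
def ValueTrivial {G : Type*} [CommGroup G] (a : Fin r → G) (k : ℕ) : Prop :=
  ∃ v : Fin r → ℕ, (∀ s, v s < 2 ^ n.size) ∧ (∀ s, IsCount n x s k (v s)) ∧ ∏ s, a s ^ v s = 1

/-- There is a digit at position `p`. -/
def IsDigit (p : ℕ) : Prop :=
  At n x p (.bit false) ∨ At n x p (.bit true)

/-- The digit with weight `z` is one. -/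
def DigitOne (z : ℕ) : Prop :=
  ∃ p < 2 ^ n.size, At n x p (.bit true) ∧
    {y | y < 2 ^ n.size ∧ IsTop y y ∧ y < z}.ncard =
    {y | y < 2 ^ n.size ∧ IsDigit n x y ∧ y < p}.ncard

/-- `k` is less than the number in the input. -/
def LtNumber (k : ℕ) : Prop :=
  (∃ p < 2 ^ n.size, At n x p (.bit true) ∧
    {y | y < 2 ^ n.size ∧ IsTop y y}.ncard ≤
    {y | y < 2 ^ n.size ∧ IsDigit n x y ∧ y < p}.ncard) ∨
  ¬ {y | y < 2 ^ n.size ∧ ∃ z < 2 ^ n.size, IsTop z y ∧ DigitOne n x z}.ncard ≤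
    {y | y < 2 ^ n.size ∧ y < k}.ncard

end Formulas

/-- The letters that may follow a letter in an encoded instance. -/
def Follows {S : Type} : InputSymbol S → InputSymbol S → Bool
  | .letter _, .letter _ => true
  | .letter _, .endEntry => true
  | .endEntry, .letter _ => true
  | .endEntry, .endEntry => true
  | .endEntry, .endTuple => true
  | .endTuple, .letter _ => true
  | .endTuple, .endEntry => true
  | .endTuple, .bit _ => true
  | .bit _, .bit _ => true
  | _, _ => false

/-- The letters at the end of an encoded instance. -/
def IsLastLetter {S : Type} : InputSymbol S → Bool
  | .endTuple => true
  | .bit b => b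
  | _ => false

/-- The word encodes an instance of the membership problem. -/
def WellFormed (n : ℕ) {S : Type} (x : Fin n → InputSymbol S) : Prop :=
  (∀ p < 2 ^ n.size, (∀ z < 2 ^ n.size, ¬ z < p) → ∀ s, At n x p s → Follows .endTuple s = true) ∧
  (∀ p < 2 ^ n.size, ∀ p' < 2 ^ n.size, p < p' → (∀ z < 2 ^ n.size, ¬ (p < z ∧ z < p')) →
    ∀ s s', At n x p s → At n x p' s' → Follows s s' = true) ∧
  ∀ p < 2 ^ n.size, (∀ z < 2 ^ n.size, p < z → ¬ ∃ s, At n x z s) →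
    ∀ s, At n x p s → IsLastLetter s = true

/-! ### Definability of the formulas -/

namespace Definable

theorem congr {P P' : WordPred A} (h : Definable P)
    (h' : ∀ n (x : Fin n → A) e, P n x e ↔ P' n x e) :
    Definable P' := by
  have : P = P' := by
    funext n x e
    exact propext (h' n x e)
  exact this ▸ h

theorem const (p : Prop) : Definable fun n (_ : Fin n → A) _ => p :=
  atom (Automatic.const p)

theorem lt (i j : ℕ) : Definable fun n (_ : Fin n → A) e => e i < e j :=
  atom (Automatic.lt i j)

theorem eq (i j : ℕ) : Definable fun n (_ : Fin n → A) e => e i = e j :=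
  atom (Automatic.eq i j)

theorem isTop (i j : ℕ) : Definable fun n (_ : Fin n → A) e => IsTop (e i) (e j) :=
  atom (Automatic.top i j)

theorem letterAt (j : ℕ) (s : A) : Definable fun n (x : Fin n → A) e => At n x (e j) s :=
  input j s

theorem ncard_eq {P P' : WordPred A} (i : ℕ) (h : Definable P) (h' : Definable P') :
    Definable fun n x e =>
      {y | y < 2 ^ n.size ∧ P n x (Function.update e i y)}.ncard =
      {y | y < 2 ^ n.size ∧ P' n x (Function.update e i y)}.ncard := by
  simpa only [le_antisymm_iff] using (ncard_le i h h').and (ncard_le i h' h)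

theorem ncard_pairs_eq {P P' : WordPred A} {i j : ℕ} (hij : i ≠ j) (h : Definable P)
    (h' : Definable P') :
    Definable fun n x e =>
      {y : ℕ × ℕ | y.1 < 2 ^ n.size ∧ y.2 < 2 ^ n.size ∧
        P n x (Function.update (Function.update e i y.1) j y.2)}.ncard =
      {y : ℕ × ℕ | y.1 < 2 ^ n.size ∧ y.2 < 2 ^ n.size ∧
        P' n x (Function.update (Function.update e i y.1) j y.2)}.ncard := by
  simpa only [le_antisymm_iff] using (ncard_pairs_le hij h h').and (ncard_pairs_le hij h' h)

variable {r : ℕ}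

theorem sameTuple : Definable fun n (x : Fin n → InputSymbol (Fin r)) e =>
    SameTuple n x (e 4) (e 1) := by
  refine (((letterAt 5 .endTuple).imp ((((lt 4 5).and (lt 5 1)).not).and
    (((lt 1 5).and (lt 5 4)).not))).all 5).congr fun n x e => ?_
  simp [SameTuple]

theorem contributes : Definable fun n (x : Fin n → InputSymbol (Fin r)) e =>
    Contributes n x (e 1) (e 0) := by
  refine ((ncard_pairs_eq (i := 3) (j := 4) (by simp) ((letterAt 4 .endEntry).and (sameTuple.and
    ((lt 3 2).or ((eq 3 2).and (lt 4 1))))) ((eq 3 2).and (lt 4 0))).ex 2).congr fun n x e => ?_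
  simp [Contributes]

/-- The counts live in the variables from 10 on, clear of the variables 0 to 5 used in the other
formulas. -/
theorem isCount (s : Fin r) : Definable fun n (x : Fin n → InputSymbol (Fin r)) e =>
    IsCount n x s (e 0) (e (10 + s)) := by
  refine (ncard_eq 1 ((letterAt 1 (.letter s)).and contributes)
    (lt 1 (10 + s))).congr fun n x e => ?_
  have : 10 + (s : ℕ) ≠ 1 := by omega
  simp [IsCount, this]

/-- All counts are guessed by one disjunction and verified by majority gates; only the relation
between the guessed numbers is left to an automaton. -/
theorem valueTrivial {G : Type*} [CommGroup G] (a : Fin r → G)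
    (ha : Submonoid.closure (Set.range a) = ⊤) :
    Definable fun n (x : Fin n → InputSymbol (Fin r)) e => ValueTrivial n x a (e 0) := by
  refine (exists_agree (Finset.univ.image fun s : Fin r => 10 + (s : ℕ))
    ((forall_finite fun s => isCount s).and
      (atom (Automatic.prod_pow_eq_one (fun s : Fin r => 10 + (s : ℕ)) a
        ha)))).congr fun n x e => ?_
  constructor
  · rintro ⟨e', ⟨h₁, h₂⟩, h₃, h₄⟩
    refine ⟨fun s => e' (10 + s), fun s => h₁ _ (by simp), fun s => ?_, h₄⟩
    rw [← h₂ 0 (by simp)]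
    exact h₃ s
  · rintro ⟨v, h₁, h₂, h₃⟩
    let e' : ℕ → ℕ := fun i => if h : ∃ s : Fin r, 10 + (s : ℕ) = i then v h.choose else e i
    have he' : ∀ s : Fin r, e' (10 + s) = v s := fun s => by
      have h : ∃ s' : Fin r, 10 + (s' : ℕ) = 10 + s := ⟨s, rfl⟩
      have := h.choose_spec
      simp only [e', dif_pos h]
      congr 1
      exact Fin.ext (by omega)
    have h0 : e' 0 = e 0 := by simp [e']
    refine ⟨e', ⟨?_, ?_⟩, ?_, ?_⟩
    · simp only [Finset.mem_image, Finset.mem_univ, true_and, forall_exists_index,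
        forall_apply_eq_imp_iff, he']
      exact h₁
    · intro i hi
      have : ¬ ∃ s : Fin r, 10 + (s : ℕ) = i := by simpa using hi
      simp only [e', dif_neg this]
    · intro s
      rw [he', h0]
      exact h₂ s
    · simpa only [he'] using h₃

theorem isDigit (i : ℕ) : Definable fun n (x : Fin n → InputSymbol (Fin r)) e =>
    IsDigit n x (e i) :=
  (letterAt i _).or (letterAt i _)

theorem digitOne : Definable fun n (x : Fin n → InputSymbol (Fin r)) e => DigitOne n x (e 2) := by
  refine (((letterAt 1 (.bit true)).and (ncard_eq 3 ((isTop 3 3).and (lt 3 2))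
    ((isDigit 3).and (lt 3 1)))).ex 1).congr fun n x e => ?_
  simp [DigitOne]

theorem ltNumber : Definable fun n (x : Fin n → InputSymbol (Fin r)) e => LtNumber n x (e 0) := by
  refine ((((letterAt 1 (.bit true)).and
    (ncard_le 3 (isTop 3 3) ((isDigit 3).and (lt 3 1)))).ex 1).or
    (ncard_le 4 (((isTop 2 4).and digitOne).ex 2) (lt 4 0)).not).congr fun n x e => ?_
  simp [LtNumber]

theorem wellFormed : Definable fun n (x : Fin n → InputSymbol (Fin r)) _ => WellFormed n x := by
  have h₁ := ((lt 1 0).not.all 1).imp (forall_finite fun s : InputSymbol (Fin r) =>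
    (letterAt 0 s).imp (const (Follows .endTuple s = true)))
  have h₂ := (lt 0 1).imp ((((lt 0 2).and (lt 2 1)).not.all 2).imp
    (forall_finite fun s : InputSymbol (Fin r) => forall_finite fun s' =>
      (letterAt 0 s).imp ((letterAt 1 s').imp (const (Follows s s' = true)))))
  have h₃ := (((lt 0 1).imp (exists_finite fun s => letterAt 1 s).not).all 1).imp
    (forall_finite fun s : InputSymbol (Fin r) =>
      (letterAt 0 s).imp (const (IsLastLetter s = true)))
  refine ((h₁.all 0).and (((h₂.all 1).all 0).and (h₃.all 0))).congr fun n x e => ?_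
  simp [WellFormed]

end Definable

end Threshold

/-! ### Well-formed words -/

namespace Threshold

variable {S : Type}

theorem at_get {A : Type} (x : List A) (p : ℕ) (s : A) :
    At x.length x.get p s ↔ x[p]? = some s := by
  rw [List.getElem?_eq_some_iff]
  rfl

/-- The word may follow the letter in an encoded instance. -/
def MayFollow : InputSymbol S → List (InputSymbol S) → Prop
  | s, [] => IsLastLetter s = true
  | s, s' :: l => Follows s s' = true ∧ MayFollow s' l

theorem mayFollow_iff (s : InputSymbol S) (l : List (InputSymbol S)) : MayFollow s l ↔
    (∀ p s₁ s₂, (s :: l)[p]? = some s₁ → (s :: l)[p + 1]? = some s₂ → Follows s₁ s₂ = true) ∧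
    ∀ s₁, (s :: l)[l.length]? = some s₁ → IsLastLetter s₁ = true := by
  induction l generalizing s with
  | nil => simp [MayFollow]
  | cons s' l ih =>
    rw [MayFollow, ih]
    constructor
    · rintro ⟨h₁, h₂, h₃⟩
      refine ⟨?_, by simpa using h₃⟩
      rintro (_ | p) s₁ s₂ hs₁ hs₂
      · simp_all
      · exact h₂ p s₁ s₂ hs₁ hs₂
    · rintro ⟨h₁, h₂⟩
      exact ⟨h₁ 0 s s' rfl rfl, fun p s₁ s₂ => h₁ (p + 1) s₁ s₂, by simpa using h₂⟩

/-- Being an encoding is a condition on adjacent letters and on the last one. A virtual `.endTuple`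
in front of the word takes care of its first letter. -/
theorem wellFormed_iff (x : List (InputSymbol S)) :
    WellFormed x.length x.get ↔ MayFollow .endTuple x := by
  have hD := Nat.lt_size_self x.length
  have hlt : ∀ {p s}, x[p]? = some s → p < 2 ^ x.length.size := fun h =>
    (List.getElem?_eq_some_iff.1 h).1.trans hD
  rw [mayFollow_iff]
  simp only [WellFormed, at_get]
  constructor
  · rintro ⟨h₁, h₂, h₃⟩
    constructor
    · rintro (_ | p) s₁ s₂ hs₁ hs₂
      · simp only [List.getElem?_cons_zero, Option.some.injEq] at hs₁
        subst hs₁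
        exact h₁ 0 (by positivity) (by simp) s₂ hs₂
      · exact h₂ p (hlt hs₁) (p + 1) (hlt hs₂) (by omega) (by omega) s₁ s₂ hs₁ hs₂
    · intro s₁ hs₁
      -- For the empty word (no tuples, `m = 0`) the last letter is the virtual one.
      rcases hx : x.length with _ | p
      · rw [hx] at hs₁
        simp only [List.getElem?_cons_zero, Option.some.injEq] at hs₁
        subst hs₁
        rfl
      · rw [hx] at hs₁
        refine h₃ p (hlt hs₁) (fun z _ hz => ?_) s₁ hs₁
        rw [List.getElem?_eq_none (by omega)]
        simp
  · rintro ⟨h₁, h₂⟩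
    refine ⟨?_, ?_, ?_⟩
    · intro p hp hz s hs
      obtain rfl : p = 0 := by
        by_contra h
        exact hz 0 (by positivity) (by omega)
      exact h₁ 0 _ _ rfl hs
    · intro p hp p' hp' hpp hz s s' hs hs'
      obtain rfl : p' = p + 1 := by
        by_contra h
        exact hz (p + 1) (by omega) (by omega)
      exact h₁ (p + 1) _ _ hs hs'
    · intro p hp hz s hs
      have hpx := (List.getElem?_eq_some_iff.1 hs).1
      have : x.length = p + 1 := by
        by_contra h
        exact hz (p + 1) (by omega) (by omega) ⟨x[p + 1], List.getElem?_eq_getElem (by omega)⟩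
      exact h₂ s (by rw [this]; exact hs)

/-- The word for the entries of a tuple. -/
def encodeEntries (u : List (List S)) : List (InputSymbol S) :=
  u.flatMap fun w => w.map InputSymbol.letter ++ [InputSymbol.endEntry]

theorem encodeEntries_cons (w : List S) (u : List (List S)) :
    encodeEntries (w :: u) = w.map .letter ++ .endEntry :: encodeEntries u := by
  simp [encodeEntries]

theorem encodeInstance_cons (u : List (List S)) (us : List (List (List S))) (m : ℕ) :
    encodeInstance (u :: us) m = encodeEntries u ++ .endTuple :: encodeInstance us m := by
  simp [encodeInstance, encodeTuple, encodeEntries]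

theorem encodeInstance_nil (m : ℕ) :
    encodeInstance ([] : List (List (List S))) m = m.bits.map .bit := by
  simp [encodeInstance]

theorem mayFollow_bits {s : InputSymbol S} (hs : ∀ b, Follows s (.bit b) = true) {m : ℕ}
    (hm : m ≠ 0) : MayFollow s (m.bits.map .bit) := by
  induction m using Nat.binaryRec generalizing s with
  | zero => exact absurd rfl hm
  | bit b m ih =>
    rw [Nat.bits_append_bit _ _ fun h => by
      subst h
      cases b
      · exact absurd rfl hm
      · rfl]
    refine ⟨hs b, ?_⟩
    by_cases h : m = 0
    · subst h
      cases b
      · exact absurd rfl hm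
      · simp [MayFollow, IsLastLetter]
    · exact ih (fun _ => rfl) h

theorem mayFollow_word {s : InputSymbol S} (hs : Follows s .endEntry = true)
    (hs' : ∀ g, Follows s (.letter g) = true) (w : List S) {l : List (InputSymbol S)}
    (hl : MayFollow .endEntry l) : MayFollow s (w.map .letter ++ .endEntry :: l) := by
  induction w generalizing s with
  | nil => exact ⟨hs, hl⟩
  | cons g w ih => exact ⟨hs' g, ih rfl fun _ => rfl⟩

theorem mayFollow_entries (u : List (List S)) {l : List (InputSymbol S)}
    (hl : MayFollow .endTuple l) : MayFollow .endEntry (encodeEntries u ++ .endTuple :: l) := by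
  induction u with
  | nil => exact ⟨rfl, hl⟩
  | cons w u ih =>
    rw [encodeEntries_cons, List.append_assoc]
    exact mayFollow_word rfl (fun _ => rfl) w ih

theorem mayFollow_encodeInstance (us : List (List (List S))) (hus : ∀ u ∈ us, u ≠ []) (m : ℕ) :
    MayFollow .endTuple (encodeInstance us m) := by
  induction us with
  | nil =>
    rw [encodeInstance_nil]
    by_cases hm : m = 0
    · simp [hm, MayFollow, IsLastLetter]
    · exact mayFollow_bits (fun _ => rfl) hm
  | cons u us ih =>
    rw [encodeInstance_cons]
    cases u with
    | nil => exact absurd rfl (hus [] (by simp))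
    | cons w u =>
      rw [encodeEntries_cons, List.append_assoc]
      exact mayFollow_word rfl (fun _ => rfl) w
        (mayFollow_entries u (ih fun u hu => hus u (List.mem_cons_of_mem _ hu)))

/-- The remainder of an encoded instance after a letter. -/
def IsRemainder : InputSymbol S → List (InputSymbol S) → Prop
  | .letter _, l => ∃ (w : List S) (u : List (List S)) (us : List (List (List S))) (m : ℕ),
      (∀ u ∈ us, u ≠ []) ∧
      l = w.map .letter ++ .endEntry :: (encodeEntries u ++ .endTuple :: encodeInstance us m)
  | .endEntry, l => ∃ (u : List (List S)) (us : List (List (List S))) (m : ℕ), (∀ u ∈ us, u ≠ []) ∧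
      l = encodeEntries u ++ .endTuple :: encodeInstance us m
  | .endTuple, l => ∃ (us : List (List (List S))) (m : ℕ),
      (∀ u ∈ us, u ≠ []) ∧ l = encodeInstance us m
  | .bit b, l => ∃ m, m ≠ 0 ∧ .bit b :: l = (Nat.bits m).map .bit

/-- Parsing from the right: each admissible pair of letters tells how the parse of the remainder is
extended by one letter. -/
theorem MayFollow.isRemainder {s : InputSymbol S} {l : List (InputSymbol S)}
    (h : MayFollow s l) : IsRemainder s l := by
  induction l generalizing s with
  | nil =>
    cases s with
    | letter g => cases h
    | endEntry => cases h
    | endTuple => exact ⟨[], 0, by simp, by simp [encodeInstance]⟩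
    | bit b =>
      cases b
      · cases h
      · exact ⟨1, one_ne_zero, by simp⟩
  | cons s' l ih =>
    obtain ⟨h₁, h₂⟩ := h
    have hr := ih h₂
    cases s with
    | letter g =>
      cases s' with
      | letter g' =>
        obtain ⟨w, u, us, m, hus, rfl⟩ := hr
        exact ⟨g' :: w, u, us, m, hus, rfl⟩
      | endEntry =>
        obtain ⟨u, us, m, hus, rfl⟩ := hr
        exact ⟨[], u, us, m, hus, rfl⟩
      | _ => cases h₁
    | endEntry =>
      cases s' with
      | letter g' =>
        obtain ⟨w, u, us, m, hus, rfl⟩ := hr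
        exact ⟨(g' :: w) :: u, us, m, hus, by simp [encodeEntries_cons]⟩
      | endEntry =>
        obtain ⟨u, us, m, hus, rfl⟩ := hr
        exact ⟨[] :: u, us, m, hus, by simp [encodeEntries_cons]⟩
      | endTuple =>
        obtain ⟨us, m, hus, rfl⟩ := hr
        exact ⟨[], us, m, hus, rfl⟩
      | bit b => cases h₁
    | endTuple =>
      cases s' with
      | letter g' =>
        obtain ⟨w, u, us, m, hus, rfl⟩ := hr
        exact ⟨((g' :: w) :: u) :: us, m, by simpa using hus,
          by simp [encodeInstance_cons, encodeEntries_cons]⟩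
      | endEntry =>
        obtain ⟨u, us, m, hus, rfl⟩ := hr
        exact ⟨([] :: u) :: us, m, by simpa using hus,
          by simp [encodeInstance_cons, encodeEntries_cons]⟩
      | endTuple => cases h₁
      | bit b =>
        obtain ⟨m, -, hm⟩ := hr
        exact ⟨[], m, by simp, by rw [encodeInstance_nil, hm]⟩
    | bit b =>
      cases s' with
      | bit b' =>
        obtain ⟨m, hm, hl⟩ := hr
        refine ⟨Nat.bit b m, by simp [Nat.bit_eq_zero_iff, hm], ?_⟩
        rw [hl, Nat.bits_append_bit _ _ fun h => absurd h hm, List.map_cons]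
      | _ => cases h₁

theorem mayFollow_endTuple_iff (x : List (InputSymbol S)) : MayFollow .endTuple x ↔
    ∃ (us : List (List (List S))) (m : ℕ), (∀ u ∈ us, u ≠ []) ∧ x = encodeInstance us m :=
  ⟨fun h => h.isRemainder, fun ⟨us, m, hus, h⟩ => h ▸ mayFollow_encodeInstance us hus m⟩

end Threshold

/-! ### The number in the input -/

namespace Threshold

theorem isTop_self_iff {y : ℕ} : IsTop y y ↔ ∃ i, y = 2 ^ i := by
  constructor
  · rintro ⟨-, h⟩
    exact ⟨_, h⟩
  · rintro ⟨i, rfl⟩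
    exact ⟨by positivity, by rw [Nat.log_pow one_lt_two]⟩

/-- There are `j` powers of two below `2 ^ j`. -/
theorem ncard_isTop {L j : ℕ} (hj : j ≤ L) : {y | y < 2 ^ L ∧ IsTop y y ∧ y < 2 ^ j}.ncard = j := by
  have : {y | y < 2 ^ L ∧ IsTop y y ∧ y < 2 ^ j} = ((Finset.range j).image fun i => 2 ^ i) := by
    ext y
    simp only [isTop_self_iff, Set.mem_ofPred_eq, Finset.coe_image, Set.mem_image, Finset.mem_coe,
      Finset.mem_range]
    constructor
    · rintro ⟨-, ⟨i, rfl⟩, h⟩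
      exact ⟨i, (Nat.pow_lt_pow_iff_right one_lt_two).1 h, rfl⟩
    · rintro ⟨i, hi, rfl⟩
      have := Nat.pow_lt_pow_right one_lt_two hi
      exact ⟨this.trans_le (Nat.pow_le_pow_right two_pos hj), ⟨i, rfl⟩, this⟩
  rw [this, Set.ncard_coe_finset, Finset.card_image_of_injective _ (Nat.pow_right_injective le_rfl),
    Finset.card_range]

/-- A number is determined by counting the numbers whose highest digit is one of its digits. -/
theorem ncard_testBit_log (m L : ℕ) :
    {y | y < 2 ^ L ∧ y ≠ 0 ∧ m.testBit (Nat.log 2 y) = true}.ncard = m % 2 ^ L := by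
  induction L with
  | zero =>
    rw [pow_zero, Nat.mod_one, Set.ncard_eq_zero ((Set.finite_lt_nat 1).subset fun _ h => h.1)]
    ext y
    simp +contextual
  | succ L ih =>
    -- The numbers with leading digit at place `L` form an interval of `2 ^ L` elements, the weight
    -- of that digit in `m`.
    have hsplit : {y | y < 2 ^ (L + 1) ∧ y ≠ 0 ∧ m.testBit (Nat.log 2 y) = true} =
        {y | y < 2 ^ L ∧ y ≠ 0 ∧ m.testBit (Nat.log 2 y) = true} ∪
        {y | (2 ^ L ≤ y ∧ y < 2 ^ (L + 1)) ∧ m.testBit L = true} := by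
      ext y
      simp only [Set.mem_union, Set.mem_ofPred_eq]
      rcases Nat.lt_or_ge y (2 ^ L) with h | h
      · have : y < 2 ^ (L + 1) := h.trans (Nat.pow_lt_pow_right one_lt_two L.lt_succ_self)
        simp [h, this, h.not_ge]
      · have h0 : y ≠ 0 := (Nat.two_pow_pos L).trans_le h |>.ne'
        by_cases h' : y < 2 ^ (L + 1)
        · simp [h, h', h.not_gt, h0, (Nat.log_eq_iff (Or.inr ⟨one_lt_two, h0⟩)).2 ⟨h, h'⟩]
        · simp [h', h.not_gt]
    have hfin : Finite {y | y < 2 ^ L ∧ y ≠ 0 ∧ m.testBit (Nat.log 2 y) = true} :=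
      (Set.finite_lt_nat (2 ^ L)).subset fun _ h => h.1
    have hfin' : Finite {y | (2 ^ L ≤ y ∧ y < 2 ^ (L + 1)) ∧ m.testBit L = true} :=
      (Set.finite_lt_nat (2 ^ (L + 1))).subset fun _ h => h.1.2
    rw [hsplit, Set.ncard_union_eq (Set.disjoint_left.2 fun y h h' => h'.1.1.not_gt h.1), ih,
      Nat.mod_pow_succ, ← Nat.toNat_testBit]
    congr 1
    cases hb : m.testBit L
    · simp
    · have : {y | (2 ^ L ≤ y ∧ y < 2 ^ (L + 1)) ∧ true = true} =
          (Finset.Ico (2 ^ L) (2 ^ (L + 1)) : Finset ℕ) := by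
        ext y
        simp
      rw [this, Set.ncard_coe_finset, Nat.card_Ico, pow_succ, Bool.toNat_true]
      omega

section

variable {r : ℕ} (us : List (List (List (Fin r)))) (m : ℕ)

theorem getElem?_encodeInstance_eq_bit (p : ℕ) (b : Bool) :
    (encodeInstance us m)[p]? = some (.bit b) ↔
      (us.flatMap encodeTuple).length ≤ p ∧
        m.bits[p - (us.flatMap encodeTuple).length]? = some b := by
  unfold encodeInstance
  rcases Nat.lt_or_ge p (us.flatMap encodeTuple).length with h | h
  · rw [List.getElem?_append_left h]
    simp only [h.not_ge, false_and, iff_false]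
    intro hb
    have := List.mem_of_getElem? hb
    simp [encodeTuple] at this
  · rw [List.getElem?_append_right h, List.getElem?_map, and_iff_right h]
    simp

/-- Either `m` has a one at a place `≥ L`, whence `k < 2 ^ L ≤ m`, or `m` is recovered from its
lowest `L` digits by `ncard_testBit_log`. Places are matched by counting: as many digits precede a
digit in the word as there are powers of two below its weight. -/
theorem ltNumber_iff {k : ℕ} (hk : k < 2 ^ (encodeInstance us m).length.size) :
    LtNumber (encodeInstance us m).length (encodeInstance us m).get k ↔ k < m := by
  set x := encodeInstance us m with hx
  set n₀ := (us.flatMap encodeTuple).length with hn₀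
  set L := x.length.size
  have hlen : x.length = n₀ + m.bits.length := by
    simp [hx, encodeInstance, hn₀]
  have hD : x.length < 2 ^ L := Nat.lt_size_self _
  have hbit : ∀ p b, At x.length x.get p (.bit b) ↔ n₀ ≤ p ∧ m.bits[p - n₀]? = some b :=
    fun p b => (at_get _ _ _).trans (getElem?_encodeInstance_eq_bit us m p b)
  have htest : ∀ j, m.bits[j]? = some true ↔ m.testBit j = true := by
    intro j
    rw [← Nat.getElem?_bits]
    cases m.bits[j]? <;> simp
  have hone : ∀ p, At x.length x.get p (.bit true) ↔ ∃ j, p = n₀ + j ∧ m.testBit j = true := by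
    intro p
    rw [hbit, htest]
    constructor
    · rintro ⟨h, h'⟩
      exact ⟨p - n₀, by omega, h'⟩
    · rintro ⟨j, rfl, h⟩
      exact ⟨by omega, by simpa using h⟩
  have hdig : ∀ p, IsDigit x.length x.get p ↔ n₀ ≤ p ∧ p < x.length := by
    intro p
    rw [IsDigit, hbit, hbit, ← and_or_left, hlen]
    refine and_congr_right fun h => ?_
    rcases Nat.lt_or_ge (p - n₀) m.bits.length with h' | h'
    · rw [List.getElem?_eq_getElem h']
      cases m.bits[p - n₀] <;> simp <;> omega
    · rw [List.getElem?_eq_none h']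
      simp
      omega
  have hlt : ∀ j, m.testBit j = true → n₀ + j < x.length := by
    intro j hj
    have := (List.getElem?_eq_some_iff.1 ((htest j).2 hj)).1
    omega
  have hcount : ∀ j, m.testBit j = true →
      {y | y < 2 ^ L ∧ IsDigit x.length x.get y ∧ y < n₀ + j}.ncard = j := by
    intro j hj
    have : {y | y < 2 ^ L ∧ IsDigit x.length x.get y ∧ y < n₀ + j} =
        (Finset.Ico n₀ (n₀ + j) : Finset ℕ) := by
      ext y
      have := hlt j hj
      simp only [hdig, Set.mem_ofPred_eq, Finset.coe_Ico, Set.mem_Ico]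
      omega
    rw [this, Set.ncard_coe_finset, Nat.card_Ico]
    omega
  have hdigit : ∀ i, 2 ^ i < 2 ^ L → (DigitOne x.length x.get (2 ^ i) ↔ m.testBit i = true) := by
    intro i hi
    have hi' := ncard_isTop ((Nat.pow_lt_pow_iff_right one_lt_two).1 hi).le
    constructor
    · rintro ⟨p, -, hp, h⟩
      obtain ⟨j, rfl, hj⟩ := (hone p).1 hp
      rw [hcount j hj, hi'] at h
      exact h ▸ hj
    · intro h
      exact ⟨n₀ + i, (hlt i h).trans hD, (hone _).2 ⟨i, rfl, h⟩, by rw [hcount i h, hi']⟩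
  have hset : {y | y < 2 ^ L ∧ ∃ z < 2 ^ L, IsTop z y ∧ DigitOne x.length x.get z} =
      {y | y < 2 ^ L ∧ y ≠ 0 ∧ m.testBit (Nat.log 2 y) = true} := by
    ext y
    refine and_congr_right fun hy => ?_
    constructor
    · rintro ⟨z, hz, ⟨h0, rfl⟩, h⟩
      exact ⟨h0, (hdigit _ hz).1 h⟩
    · rintro ⟨h0, h⟩
      have := (Nat.pow_log_le_self 2 h0).trans_lt hy
      exact ⟨_, this, ⟨h0, rfl⟩, (hdigit _ this).2 h⟩
  have hbelow : {y | y < 2 ^ L ∧ y < k}.ncard = k := by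
    have : {y | y < 2 ^ L ∧ y < k} = (Finset.range k : Finset ℕ) := by
      ext y
      simp
      omega
    rw [this, Set.ncard_coe_finset, Finset.card_range]
  have htop : {y | y < 2 ^ L ∧ IsTop y y}.ncard = L := by
    refine Eq.trans (congrArg _ (Set.ext fun y => ?_)) (ncard_isTop (le_refl L))
    exact ⟨fun h => ⟨h.1, h.2, h.1⟩, fun h => ⟨h.1, h.2.1⟩⟩
  rw [LtNumber, hset, ncard_testBit_log, hbelow, htop, not_le]
  constructor
  · rintro (⟨p, -, hp, h⟩ | h)
    · obtain ⟨j, rfl, hj⟩ := (hone p).1 hp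
      rw [hcount j hj] at h
      exact hk.trans_le ((Nat.pow_le_pow_right two_pos h).trans (Nat.ge_two_pow_of_testBit hj))
    · exact h.trans_le (Nat.mod_le _ _)
  · intro h
    by_cases hm : ∃ j, L ≤ j ∧ m.testBit j = true
    · obtain ⟨j, hjL, hj⟩ := hm
      exact Or.inl ⟨n₀ + j, (hlt j hj).trans hD, (hone _).2 ⟨j, rfl, hj⟩, by rwa [hcount j hj]⟩
    · push Not at hm
      rw [Nat.mod_eq_of_lt (Nat.lt_pow_two_of_testBit _ fun j hj => by simpa using hm j hj)]
      exact Or.inr h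

end

end Threshold

/-! ### The value of an instance -/

namespace Threshold

/-! ### Counting the entries of a tuple -/

section Entries

variable {S : Type}

/-- The number of entries that are closed before the end of the tuple. -/
def entriesLeft : List (InputSymbol S) → ℕ
  | [] => 0
  | .endEntry :: l => entriesLeft l + 1
  | .endTuple :: _ => 0
  | .letter _ :: l => entriesLeft l
  | .bit _ :: l => entriesLeft l

/-- A letter lies in an entry that is still open. This keeps the index of the entry below the length
of its tuple. -/
theorem MayFollow.entriesLeft_pos {s : S} {l : List (InputSymbol S)}
    (h : MayFollow (.letter s) l) : 0 < entriesLeft l := by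
  induction l generalizing s with
  | nil => cases h
  | cons s' l ih =>
    obtain ⟨h₁, h₂⟩ := h
    cases s' with
    | letter g => exact ih h₂
    | endEntry => exact Nat.succ_pos _
    | _ => cases h₁

variable (x : List (InputSymbol S))

/-- The ends of the entries that precede position `p` in its tuple. -/
def endsBefore (p : ℕ) : Set ℕ :=
  {y | x[y]? = some .endEntry ∧ y < p ∧ ∀ z, x[z]? = some .endTuple → ¬ (y < z ∧ z < p)}

/-- The ends of the other entries in the tuple of position `p`. -/
def endsFrom (p : ℕ) : Set ℕ :=
  {y | x[y]? = some .endEntry ∧ p ≤ y ∧ ∀ z, x[z]? = some .endTuple → ¬ (p ≤ z ∧ z < y)}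

theorem finite_endsBefore (p : ℕ) : (endsBefore x p).Finite :=
  (Set.finite_lt_nat p).subset fun _ h => h.2.1

theorem finite_endsFrom (p : ℕ) : (endsFrom x p).Finite :=
  (Set.finite_lt_nat x.length).subset fun _ h => (List.getElem?_eq_some_iff.1 h.1).1

variable {x} {p : ℕ}

theorem endsBefore_zero : endsBefore x 0 = ∅ := by
  ext y
  simp [endsBefore]

theorem endsBefore_succ_endEntry (h : x[p]? = some .endEntry) :
    endsBefore x (p + 1) = insert p (endsBefore x p) := by
  ext y
  simp only [endsBefore, Set.mem_insert_iff, Set.mem_ofPred_eq]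
  constructor
  · rintro ⟨h₁, h₂, h₃⟩
    by_cases hy : y = p
    · exact Or.inl hy
    · exact Or.inr ⟨h₁, by omega, fun z hz hz' => h₃ z hz (by omega)⟩
  · rintro (rfl | ⟨h₁, h₂, h₃⟩)
    · exact ⟨h, by omega, fun z hz hz' => by omega⟩
    · refine ⟨h₁, by omega, fun z hz hz' => ?_⟩
      obtain rfl : z = p := by
        by_contra hzp
        exact h₃ z hz (by omega)
      simp [h] at hz

theorem endsBefore_succ_endTuple (h : x[p]? = some .endTuple) : endsBefore x (p + 1) = ∅ := by
  refine Set.eq_empty_of_forall_notMem ?_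
  rintro y ⟨h₁, h₂, h₃⟩
  have : y ≠ p := by
    rintro rfl
    simp [h] at h₁
  exact h₃ p h (by omega)

theorem endsBefore_succ (h : x[p]? ≠ some .endEntry) (h' : x[p]? ≠ some .endTuple) :
    endsBefore x (p + 1) = endsBefore x p := by
  ext y
  constructor
  · rintro ⟨h₁, h₂, h₃⟩
    have : y ≠ p := by
      rintro rfl
      exact h h₁
    exact ⟨h₁, by omega, fun z hz hz' => h₃ z hz (by omega)⟩
  · rintro ⟨h₁, h₂, h₃⟩
    refine ⟨h₁, by omega, fun z hz hz' => ?_⟩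
    have : z ≠ p := by
      rintro rfl
      exact h' hz
    exact h₃ z hz (by omega)

theorem endsFrom_endEntry (h : x[p]? = some .endEntry) :
    endsFrom x p = insert p (endsFrom x (p + 1)) := by
  ext y
  simp only [endsFrom, Set.mem_insert_iff, Set.mem_ofPred_eq]
  constructor
  · rintro ⟨h₁, h₂, h₃⟩
    by_cases hy : y = p
    · exact Or.inl hy
    · exact Or.inr ⟨h₁, by omega, fun z hz hz' => h₃ z hz (by omega)⟩
  · rintro (rfl | ⟨h₁, h₂, h₃⟩)
    · exact ⟨h, le_rfl, fun z hz hz' => by omega⟩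
    · refine ⟨h₁, by omega, fun z hz hz' => ?_⟩
      obtain rfl : z = p := by
        by_contra hzp
        exact h₃ z hz (by omega)
      simp [h] at hz

theorem endsFrom_endTuple (h : x[p]? = some .endTuple) : endsFrom x p = ∅ := by
  refine Set.eq_empty_of_forall_notMem ?_
  rintro y ⟨h₁, h₂, h₃⟩
  have : y ≠ p := by
    rintro rfl
    simp [h] at h₁
  exact h₃ p h (by omega)

theorem endsFrom_eq_succ (h : x[p]? ≠ some .endEntry) (h' : x[p]? ≠ some .endTuple) :
    endsFrom x p = endsFrom x (p + 1) := by
  ext y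
  constructor
  · rintro ⟨h₁, h₂, h₃⟩
    have : y ≠ p := by
      rintro rfl
      exact h h₁
    exact ⟨h₁, by omega, fun z hz hz' => h₃ z hz (by omega)⟩
  · rintro ⟨h₁, h₂, h₃⟩
    refine ⟨h₁, by omega, fun z hz hz' => ?_⟩
    have : z ≠ p := by
      rintro rfl
      exact h' hz
    exact h₃ z hz (by omega)

theorem getElem?_of_drop_eq_cons {A : Type} {x l : List A} {s : A} {p : ℕ}
    (h : x.drop p = s :: l) : x[p]? = some s ∧ x.drop (p + 1) = l := by
  constructor
  · rw [← List.head?_drop, h]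
    rfl
  · rw [← List.tail_drop, h]
    rfl

theorem ncard_endsFrom {l : List (InputSymbol S)} (h : x.drop p = l) :
    (endsFrom x p).ncard = entriesLeft l := by
  induction l generalizing p with
  | nil =>
    rw [List.drop_eq_nil_iff] at h
    have : endsFrom x p = ∅ := by
      refine Set.eq_empty_of_forall_notMem ?_
      rintro y ⟨h₁, h₂, -⟩
      rw [List.getElem?_eq_none (h.trans h₂)] at h₁
      cases h₁
    simp [this, entriesLeft]
  | cons s l ih =>
    obtain ⟨hs, hl⟩ := getElem?_of_drop_eq_cons h
    cases s with
    | endEntry =>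
      rw [endsFrom_endEntry hs, Set.ncard_insert_of_notMem (fun h' => by have := h'.2.1; omega)
        (finite_endsFrom x _), ih hl, entriesLeft]
    | endTuple => simp [endsFrom_endTuple hs, entriesLeft]
    | _ => rw [endsFrom_eq_succ (by simp [hs]) (by simp [hs]), ih hl, entriesLeft]

end Entries

variable {r : ℕ} {x : List (InputSymbol (Fin r))}

theorem sameTuple_iff {y p : ℕ} {s : Fin r} (hp : x[p]? = some (.letter s)) :
    x[y]? = some .endEntry ∧ SameTuple x.length x.get y p ↔
      y ∈ endsBefore x p ∪ endsFrom x p := by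
  have hz : ∀ z, x[z]? = some .endTuple → z < 2 ^ x.length.size ∧ z ≠ p := by
    intro z hz
    refine ⟨(List.getElem?_eq_some_iff.1 hz).1.trans (Nat.lt_size_self _), ?_⟩
    rintro rfl
    simp [hp] at hz
  simp only [SameTuple, at_get, endsBefore, endsFrom, Set.mem_union, Set.mem_ofPred_eq,
    ← and_or_left]
  refine and_congr_right fun _ => ?_
  constructor
  · intro h
    rcases Nat.lt_or_ge y p with hy | hy
    · exact Or.inl ⟨hy, fun z h' => (h z (hz z h').1 h').1⟩
    · refine Or.inr ⟨hy, fun z h' h'' => (h z (hz z h').1 h').2 ?_⟩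
      have := (hz z h').2
      omega
  · rintro (⟨hy, h⟩ | ⟨hy, h⟩) z - h'
    · have := h z h'
      omega
    · have := h z h'
      omega

/-- Counting pairs replaces a multiplication. The tuple has length `q = e + entriesLeft l`, and `k %
q = e` means `k = t * q + e` for some `t`. -/
theorem contributes_iff {l : List (InputSymbol (Fin r))} {s : Fin r} {p k : ℕ}
    (hp : x.drop p = .letter s :: l) (hl : 0 < entriesLeft l) (hk : k < 2 ^ x.length.size) :
    Contributes x.length x.get p k ↔
      k % ((endsBefore x p).ncard + entriesLeft l) = (endsBefore x p).ncard := by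
  set D := 2 ^ x.length.size
  set e := (endsBefore x p).ncard with he
  have hs := (getElem?_of_drop_eq_cons hp).1
  have hfrom : (endsFrom x p).ncard = entriesLeft l :=
    (ncard_endsFrom hp).trans rfl
  have hdisj : Disjoint (endsBefore x p) (endsFrom x p) :=
    Set.disjoint_left.2 fun y h h' => absurd h.2.1 h'.2.1.not_gt
  have hunion : (endsBefore x p ∪ endsFrom x p).ncard = e + entriesLeft l := by
    rw [Set.ncard_union_eq hdisj (finite_endsBefore x p) (finite_endsFrom x p), hfrom]
  have hx : ∀ {y s'}, x[y]? = some s' → y < D := fun h =>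
    (List.getElem?_eq_some_iff.1 h).1.trans (Nat.lt_size_self _)
  -- These are `t` full copies of the tuple's entry ends and one copy of those before `p`.
  have hleft : ∀ t < D, {y : ℕ × ℕ | y.1 < D ∧ y.2 < D ∧ At x.length x.get y.2 .endEntry ∧
      SameTuple x.length x.get y.2 p ∧ (y.1 < t ∨ y.1 = t ∧ y.2 < p)}.ncard =
      t * (e + entriesLeft l) + e := by
    intro t ht
    have : {y : ℕ × ℕ | y.1 < D ∧ y.2 < D ∧ At x.length x.get y.2 .endEntry ∧
        SameTuple x.length x.get y.2 p ∧ (y.1 < t ∨ y.1 = t ∧ y.2 < p)} =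
        Set.Iio t ×ˢ (endsBefore x p ∪ endsFrom x p) ∪ {t} ×ˢ endsBefore x p := by
      ext ⟨b, y⟩
      simp only [Set.mem_ofPred_eq, Set.mem_union (b, y), Set.mem_prod, Set.mem_Iio,
        Set.mem_singleton_iff, at_get, ← sameTuple_iff hs]
      constructor
      · rintro ⟨-, -, h₁, h₂, h₃ | ⟨h₃, h₄⟩⟩
        · exact Or.inl ⟨h₃, h₁, h₂⟩
        · refine Or.inr ⟨h₃, ?_⟩
          rcases (sameTuple_iff hs).1 ⟨h₁, h₂⟩ with h | h
          · exact h
          · exact absurd h.2.1 h₄.not_ge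
      · rintro (⟨h₁, h₂, h₃⟩ | ⟨rfl, h⟩)
        · exact ⟨h₁.trans ht, hx h₂, h₂, h₃, Or.inl h₁⟩
        · obtain ⟨h₂, h₃⟩ := (sameTuple_iff hs).2 (Or.inl h)
          exact ⟨ht, hx h₂, h₂, h₃, Or.inr ⟨rfl, h.2.1⟩⟩
    rw [this, Set.ncard_union_eq _
      ((Set.finite_Iio t).prod ((finite_endsBefore x p).union (finite_endsFrom x p)))
      ((Set.finite_singleton t).prod (finite_endsBefore x p)), Set.ncard_prod, Set.ncard_prod,
      hunion, Set.ncard_singleton, one_mul]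
    · congr 2
      simp
    · refine Set.disjoint_left.2 ?_
      rintro ⟨b, y⟩ ⟨h, -⟩ ⟨h', -⟩
      exact absurd h' (ne_of_lt h)
  have hright : ∀ t < D, {y : ℕ × ℕ | y.1 < D ∧ y.2 < D ∧ y.1 = t ∧ y.2 < k}.ncard = k := by
    intro t ht
    have : {y : ℕ × ℕ | y.1 < D ∧ y.2 < D ∧ y.1 = t ∧ y.2 < k} = {t} ×ˢ Set.Iio k := by
      ext ⟨b, y⟩
      simp only [Set.mem_ofPred_eq, Set.mem_prod, Set.mem_Iio, Set.mem_singleton_iff]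
      constructor
      · rintro ⟨-, -, h⟩
        exact h
      · rintro ⟨rfl, h⟩
        exact ⟨ht, h.trans hk, rfl, h⟩
    rw [this, Set.ncard_prod, Set.ncard_singleton, one_mul]
    simp
  unfold Contributes
  constructor
  · rintro ⟨t, ht, h⟩
    rw [hleft t ht, hright t ht] at h
    rw [← h, Nat.mul_add_mod', Nat.mod_eq_of_lt (by omega)]
  · intro h
    have hdiv := Nat.div_add_mod k (e + entriesLeft l)
    have ht := (Nat.div_le_self k (e + entriesLeft l)).trans_lt hk
    refine ⟨_, ht, ?_⟩
    rw [hleft _ ht, hright _ ht, mul_comm]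
    omega

/-! ### Evaluation from left to right -/

section Scan

variable {G : Type*} [CommGroup G] (a : Fin r → G)

/-- The value for `k` of the remainder of an instance, after `e` entries of the current tuple. -/
def scan (k : ℕ) : ℕ → List (InputSymbol (Fin r)) → G
  | _, [] => 1
  | e, .letter s :: l => (if k % (e + entriesLeft l) = e then a s else 1) * scan k e l
  | e, .endEntry :: l => scan k (e + 1) l
  | _, .endTuple :: l => scan k 0 l
  | e, .bit _ :: l => scan k e l

open Classical in
/-- The generators in the value for `k`. -/
noncomputable def generatorAt (x : List (InputSymbol (Fin r))) (k p : ℕ) : G :=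
  match x[p]? with
  | some (.letter s) => if Contributes x.length x.get p k then a s else 1
  | _ => 1

/-- Bridges the positional definition used by the circuit and the recursive one: the counter of
`scan` is always the number of entries closed so far in the current tuple. -/
theorem prod_generatorAt {k : ℕ} (hk : k < 2 ^ x.length.size) {l : List (InputSymbol (Fin r))}
    {p : ℕ} {s : InputSymbol (Fin r)} (hl : MayFollow s l) (hp : x.drop p = l) :
    ∏ p' ∈ Finset.Ico p x.length, generatorAt a x k p' =
      scan a k (endsBefore x p).ncard l := by
  induction l generalizing p s with
  | nil => rw [Finset.Ico_eq_empty_of_le (List.drop_eq_nil_iff.1 hp), Finset.prod_empty, scan]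
  | cons s' l ih =>
    obtain ⟨hs, hp'⟩ := getElem?_of_drop_eq_cons hp
    obtain ⟨-, hl⟩ := hl
    rw [Finset.prod_eq_prod_Ico_succ_bot (List.getElem?_eq_some_iff.1 hs).1, ih hl hp', generatorAt,
      hs]
    cases s' with
    | letter g =>
      simp only [contributes_iff hp hl.entriesLeft_pos hk, scan,
        endsBefore_succ (x := x) (p := p) (by simp [hs]) (by simp [hs])]
    | endEntry =>
      rw [endsBefore_succ_endEntry hs, Set.ncard_insert_of_notMem
        (fun h => lt_irrefl _ h.2.1) (finite_endsBefore x p), scan, one_mul]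
    | endTuple => rw [endsBefore_succ_endTuple hs, scan, Set.ncard_empty, one_mul]
    | bit b => rw [endsBefore_succ (by simp [hs]) (by simp [hs]), scan, one_mul]

/-- Commutativity of `G` enters here: the product over positions is regrouped by generators. -/
theorem prod_pow_ncard {k : ℕ} (hx : MayFollow .endTuple x) (hk : k < 2 ^ x.length.size) :
    ∏ s, a s ^ {p | p < 2 ^ x.length.size ∧ At x.length x.get p (.letter s) ∧
      Contributes x.length x.get p k}.ncard = scan a k 0 x := by
  classical
  have hscan := prod_generatorAt a hk hx (List.drop_zero (l := x))
  rw [endsBefore_zero, Set.ncard_empty] at hscan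
  rw [← hscan]
  have hpow : ∀ s, a s ^ {p | p < 2 ^ x.length.size ∧ At x.length x.get p (.letter s) ∧
      Contributes x.length x.get p k}.ncard = ∏ p ∈ Finset.Ico 0 x.length,
        if At x.length x.get p (.letter s) ∧ Contributes x.length x.get p k then a s else 1 := by
    intro s
    rw [← Finset.prod_filter, Finset.prod_const, ← Set.ncard_coe_finset]
    congr 2
    ext p
    simp only [Finset.coe_filter, Finset.mem_Ico, Set.mem_ofPred_eq]
    constructor
    · rintro ⟨-, h, h'⟩
      exact ⟨⟨p.zero_le, h.choose⟩, h, h'⟩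
    · rintro ⟨⟨-, h⟩, h'⟩
      exact ⟨h.trans (Nat.lt_size_self _), h'⟩
  simp only [hpow]
  rw [Finset.prod_comm]
  refine Finset.prod_congr rfl fun p _ => ?_
  simp only [at_get, generatorAt]
  rcases x[p]? with _ | (s | _ | _ | _)
  · simp
  · simp [ite_and]
  all_goals simp

theorem valueTrivial_iff {k : ℕ} (hx : MayFollow .endTuple x) (hk : k < 2 ^ x.length.size) :
    ValueTrivial x.length x.get a k ↔ scan a k 0 x = 1 := by
  rw [← prod_pow_ncard a hx hk]
  have hbelow : ∀ v < 2 ^ x.length.size, {p | p < 2 ^ x.length.size ∧ p < v}.ncard = v := by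
    intro v hv
    have : {p | p < 2 ^ x.length.size ∧ p < v} = Set.Iio v :=
      Set.ext fun p => ⟨fun h => h.2, fun h => ⟨lt_trans h hv, h⟩⟩
    rw [this]
    simp
  constructor
  · rintro ⟨v, h₁, h₂, h₃⟩
    rw [← h₃]
    refine Finset.prod_congr rfl fun s _ => ?_
    rw [← hbelow (v s) (h₁ s), ← h₂ s]
  · intro h
    -- The counts are at most the input length, so they lie in the range of the quantified
    -- variables.
    have hlt : ∀ s, {p | p < 2 ^ x.length.size ∧ At x.length x.get p (.letter s) ∧
        Contributes x.length x.get p k}.ncard < 2 ^ x.length.size := by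
      intro s
      refine lt_of_le_of_lt ?_ (Nat.lt_size_self x.length)
      refine (Set.ncard_le_ncard (t := Set.Iio x.length) ?_ (Set.finite_Iio _)).trans ?_
      · rintro p ⟨-, h, -⟩
        exact h.choose
      · simp
    exact ⟨_, hlt, fun s => (hbelow _ (hlt s)).symm, h⟩

theorem scan_bits (k e : ℕ) (l : List Bool) : scan a k e (l.map .bit) = 1 := by
  induction l with
  | nil => rfl
  | cons b l ih => exact ih

theorem entriesLeft_word {S : Type} (w : List S) (l : List (InputSymbol S)) :
    entriesLeft (w.map .letter ++ .endEntry :: l) = entriesLeft l + 1 := by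
  induction w with
  | nil => rfl
  | cons g w ih => exact ih

theorem entriesLeft_entries {S : Type} (u : List (List S)) (l : List (InputSymbol S)) :
    entriesLeft (encodeEntries u ++ .endTuple :: l) = u.length := by
  induction u with
  | nil => rfl
  | cons w u ih =>
    rw [encodeEntries_cons, List.append_assoc, List.cons_append, entriesLeft_word, ih,
      List.length_cons]

theorem scan_word (k e : ℕ) (w : List (Fin r)) (l : List (InputSymbol (Fin r))) :
    scan a k e (w.map .letter ++ .endEntry :: l) =
      (if k % (e + 1 + entriesLeft l) = e then (w.map a).prod else 1) * scan a k (e + 1) l := by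
  induction w with
  | nil => simp [scan]
  | cons g w ih =>
    rw [List.map_cons, List.cons_append, scan, ih, entriesLeft_word, List.map_cons, List.prod_cons,
      ← mul_assoc, add_comm (entriesLeft l) 1, ← add_assoc]
    split_ifs <;> simp

/-- Along the induction `e + u.length` stays equal to the length of the whole tuple, so the residue
of `k` does not change while `e` grows past it. -/
theorem scan_entries (k e : ℕ) (u : List (List (Fin r))) (l : List (InputSymbol (Fin r))) :
    scan a k e (encodeEntries u ++ .endTuple :: l) =
      (if e ≤ k % (e + u.length) then
        (evalTuple a u).getD (k % (e + u.length) - e) 1 else 1) * scan a k 0 l := by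
  induction u generalizing e with
  | nil => simp [encodeEntries, evalTuple, scan]
  | cons w u ih =>
    have hlen : e + (w :: u).length = e + 1 + u.length := by
      rw [List.length_cons]
      omega
    rw [encodeEntries_cons, List.append_assoc, List.cons_append, scan_word, ih,
      entriesLeft_entries, hlen, ← mul_assoc]
    congr 1
    set κ := k % (e + 1 + u.length)
    rcases lt_trichotomy κ e with h | h | h
    · rw [if_neg h.ne, if_neg (by omega), if_neg (by omega), one_mul]
    · rw [if_pos h, if_neg (by omega), if_pos h.ge, h, Nat.sub_self, mul_one]
      rfl
    · rw [if_neg h.ne', if_pos (by omega), if_pos h.le, one_mul,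
        show κ - e = κ - (e + 1) + 1 by omega]
      rfl

theorem scan_encodeInstance (us : List (List (List (Fin r)))) (m k : ℕ) :
    scan a k 0 (encodeInstance us m) =
      (us.map fun u => tupleSeq (evalTuple a u)).prod k := by
  induction us with
  | nil => rw [encodeInstance_nil, scan_bits, List.map_nil, List.prod_nil, Pi.one_apply]
  | cons u us ih =>
    rw [encodeInstance_cons, scan_entries, ih, List.map_cons, List.prod_cons, Pi.mul_apply]
    simp [tupleSeq, evalTuple]

end Scan

end Threshold

/-! ### The main theorem -/

namespace Threshold

variable {r : ℕ}

theorem periodic_tupleSeq {G : Type*} [Group G] (u : List G) :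
    Function.Periodic (tupleSeq u) u.length := fun k => by
  simp [tupleSeq]

theorem sum_length_le_length_encodeInstance {S : Type} (us : List (List (List S))) (m : ℕ) :
    (us.map List.length).sum ≤ (encodeInstance us m).length := by
  induction us with
  | nil => simp
  | cons u us ih =>
    have hu : u.length ≤ (encodeEntries u).length := by
      induction u with
      | nil => simp
      | cons w u ihu =>
        rw [encodeEntries_cons, List.length_append, List.length_cons, List.length_cons]
        omega
    rw [encodeInstance_cons, List.map_cons, List.sum_cons, List.length_append, List.length_cons]
    omega

theorem prod_tupleSeq_mem_iff {G : Type*} [CommGroup G] (a : Fin r → G)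
    {us : List (List (List (Fin r)))} (hus : ∀ u ∈ us, u ≠ []) {m D : ℕ}
    (hD : (us.map List.length).sum ≤ D) :
    (us.map fun u => tupleSeq (evalTuple a u)).prod ∈ periodicVanishingSubgroup G m ↔
      ∀ k < D, k < m → (us.map fun u => tupleSeq (evalTuple a u)).prod k = 1 := by
  have hper : ∀ u ∈ us, 1 ≤ u.length ∧ (tupleSeq (evalTuple a u)).Periodic u.length := by
    intro u hu
    refine ⟨List.length_pos_iff.2 (hus u hu), ?_⟩
    have := periodic_tupleSeq (evalTuple a u)
    rwa [evalTuple, List.length_map] at this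
  constructor
  · rintro ⟨-, h⟩ k - hk
    exact h k hk
  · intro h
    refine ⟨Subgroup.list_prod_mem _ ?_, fun k hk => ?_⟩
    · intro f hf
      obtain ⟨u, hu, rfl⟩ := List.mem_map.1 hf
      exact ⟨u.length, hper u hu⟩
    · rcases Nat.lt_or_ge k D with hkD | hkD
      · exact h k hkD hk
      have hprod : (us.map fun u => tupleSeq (evalTuple a u)).prod =
          ∏ i : Fin us.length, tupleSeq (evalTuple a us[i]) := by
        rw [← List.prod_ofFn]
        congr 1
        exact List.ext_getElem (by simp) (by simp)
      have hsum : (us.map List.length).sum = ∑ i : Fin us.length, us[i].length := by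
        rw [← List.sum_ofFn]
        congr 1
        exact List.ext_getElem (by simp) (by simp)
      rw [hprod] at h ⊢
      -- A place `k ≥ D` below `m` exists here, so every place below the sum of the periods is below
      -- both `D` and `m` and has been tested.
      rw [prod_eq_one_of_periodic Finset.univ
        (fun i : Fin us.length => tupleSeq (evalTuple a us[i]))
        (fun i => us[i].length) (fun i _ => hper _ (List.getElem_mem _))
        fun k' hk' => h k' (by omega) (by omega), Pi.one_apply]

theorem mem_membershipProblem_iff {G : Type*} [CommGroup G] (a : Fin r → G)
    (x : List (InputSymbol (Fin r))) : x ∈ membershipProblem a ↔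
      WellFormed x.length x.get ∧ ∀ k < 2 ^ x.length.size,
        LtNumber x.length x.get k → ValueTrivial x.length x.get a k := by
  have key : ∀ us m, (∀ u ∈ us, u ≠ []) → x = encodeInstance us m →
      ((us.map fun u => tupleSeq (evalTuple a u)).prod ∈ periodicVanishingSubgroup G m ↔
        ∀ k < 2 ^ x.length.size,
          LtNumber x.length x.get k → ValueTrivial x.length x.get a k) := by
    rintro us m hus rfl
    rw [prod_tupleSeq_mem_iff a hus
      ((sum_length_le_length_encodeInstance us m).trans (Nat.lt_size_self _).le)]
    refine forall₂_congr fun k hk => ?_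
    rw [ltNumber_iff us m hk, valueTrivial_iff a (mayFollow_encodeInstance us hus m) hk,
      scan_encodeInstance]
  rw [wellFormed_iff, mayFollow_endTuple_iff]
  constructor
  · rintro ⟨us, m, hus, hx, h⟩
    exact ⟨⟨us, m, hus, hx⟩, (key us m hus hx).1 h⟩
  · rintro ⟨⟨us, m, hus, hx⟩, h⟩
    exact ⟨us, m, hus, hx, (key us m hus hx).2 h⟩

end Threshold

theorem inTC0_membershipProblem {r : ℕ} {G : Type*} [CommGroup G] (a : Fin r → G)
    (ha : Submonoid.closure (Set.range a) = ⊤) : InTC0 (membershipProblem a) := by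
  have h := Threshold.Definable.wellFormed (r := r) |>.and
    ((Threshold.Definable.ltNumber.imp (Threshold.Definable.valueTrivial a ha)).all 0)
  refine h.inTC0 _ fun x => (Threshold.mem_membershipProblem_iff a x).trans ?_
  simp

theorem mainTheorem8 (G : Type*) [CommGroup G] :
    (∀ (r : ℕ) (a : Fin r → G), Submonoid.closure (Set.range a) = ⊤ →
      InTC0 (membershipProblem a)) ∧
    (∀ (n : ℕ) (f : Fin n → ℕ → G) (q : Fin n → ℕ),
      (∀ i, 1 ≤ q i ∧ Function.Periodic (f i) (q i)) →
      (∃ m : ℕ, (∏ i, f i) m ≠ 1) →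
      ∃ m : ℕ, m < ∑ i, q i ∧ (∏ i, f i) m ≠ 1) := by
  refine ⟨fun r a ha => inTC0_membershipProblem a ha, ?_⟩
  rintro n f q hq ⟨m, hm⟩
  by_contra! h
  rw [prod_eq_one_of_periodic Finset.univ f q (fun i _ => hq i) h] at hm
  exact hm rfl
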